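/- Let $[n]=\{1,\dots,n\}$ and let $\binom{[n]}{k}$ denote the family of all $k$-element subsets of $[n]$. Let $t\ge 2$, $k_1\ge k_2\ge\cdots\ge k_t$ and $n\ge k_1+k_2$, and let $\mathcal{A}_i\subset\binom{[n]}{k_i}$ ($i=1,\dots,t$) be non-empty families that are pairwise cross-intersecting, i.e. $A\cap B\neq\emptyset$ whenever $A\in\mathcal{A}_i$, $B\in\mathcal{A}_j$ and $i<j$. Put $$X=\binom{n}{k_1}-\binom{n-k_t}{k_1}+\sum_{i=2}^t\binom{n-k_t}{k_i-k_t},\qquad Y=\sum_{i=1}^t\binom{n-1}{k_i-1}.$$ Then $\sum_{i=1}^t|\mathcal{A}_i|\le\max\{X,Y\}$. Equality holds if and only if at least one of the following holds: (i) $X\ge Y$, and there are an index $s$ with $k_s=k_1$ and a $k_t$-element set $T\subset[n]$ such that $\mathcal{A}_s=\{F\in\binom{[n]}{k_s}: F\cap T\ne\emptyset\}$ and $\mathcal{A}_j=\{F\in\binom{[n]}{k_j}: T\subset F\}$ for every $j\ne s$ (that is, up to relabelling families of the same uniformity, $s=1$); (ii) $X\le Y$, there are $i\ne j$ with $n>k_i+k_j$,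 and there is $a\in[n]$ such that $\mathcal{A}_j=\{F\in\binom{[n]}{k_j}: a\in F\}$ for every $j\in[t]$; (iii) $t=2$, $n=k_1+k_2$ and $\mathcal{A}_2=\binom{[n]}{k_2}\setminus\overline{\mathcal{A}_1}$; (iv) $t\ge3$, $k_1=k_2=\cdots=k_t=k$, $n=2k$ and $\mathcal{A}_1=\mathcal{A}_2=\cdots=\mathcal{A}_t=\binom{[n]}{k}\setminus\overline{\mathcal{A}_1}$. Here $\overline{\mathcal{A}}=\{[n]\setminus A: A\in\mathcal{A}\}$. -/

import Mathlib

open Finset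

/-- Two families of subsets of `[n]` are cross-intersecting if every member of the first
meets every member of the second. -/
def CrossIntersecting {n : ℕ} (𝒜 ℬ : Finset (Finset (Fin n))) : Prop :=
  ∀ A ∈ 𝒜, ∀ B ∈ ℬ, (A ∩ B).Nonempty

/-- The families `𝒜 i`, indexed by `i : Fin t`, are non-empty and pairwise cross-intersecting. -/
def NonemptyPairwiseCrossIntersecting {n t : ℕ} (𝒜 : Fin t → Finset (Finset (Fin n))) : Prop :=
  (∀ i, (𝒜 i).Nonempty) ∧ ∀ i j, i < j → CrossIntersecting (𝒜 i) (𝒜 j)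

/-- All `k`-element subsets of `[n]`. -/
def kSubsets (n k : ℕ) : Finset (Finset (Fin n)) :=
  powersetCard k univ

/-- The `k`-element subsets of `[n]` that meet `T`. -/
def meetingFamily {n : ℕ} (k : ℕ) (T : Finset (Fin n)) : Finset (Finset (Fin n)) :=
  {F ∈ kSubsets n k | (F ∩ T).Nonempty}

/-- The `k`-element subsets of `[n]` that contain `T`. -/
def containingFamily {n : ℕ} (k : ℕ) (T : Finset (Fin n)) : Finset (Finset (Fin n)) :=
  {F ∈ kSubsets n k | T ⊆ F}

/-- The full star: the `k`-element subsets of `[n]` that contain the point `a`. -/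
def fullStar {n : ℕ} (k : ℕ) (a : Fin n) : Finset (Finset (Fin n)) :=
  {F ∈ kSubsets n k | a ∈ F}

/-- `binom(n, k₁) - binom(n - k_t, k₁) + ∑_{i = 2}^{t} binom(n - k_t, k_i - k_t)`, where
`first` and `last` are the indices of `k₁` and `k_t`. -/
def meetingBound {t : ℕ} (n : ℕ) (k : Fin t → ℕ) (first last : Fin t) : ℕ :=
  n.choose (k first) - (n - k last).choose (k first)
    + ∑ i ∈ univ.erase first, (n - k last).choose (k i - k last)

/-- `∑_{i = 1}^{t} binom(n - 1, k_i - 1)`. -/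
def starBound {t : ℕ} (n : ℕ) (k : Fin t → ℕ) : ℕ :=
  ∑ i, (n - 1).choose (k i - 1)

/-!
The total size is compared with the full stars. If no family is larger than the full star of its
uniformity, the bound is `starBound`, and equality makes every family as large as a star. In that
case Kruskal–Katona determines the families: of two cross-intersecting families with the sizes of
stars and `a + b < n`, the complements of the members of one form a family of `binom(n - 1, r)`
sets of size `r` with the smallest possible shadow, and such a family misses a point
(`exists_forall_notMem_of_card_shadow_le`), because a point of less than average degree must have
an empty link. If instead all pairs of uniformities add up to `n`, the families are complementary
in pairs.

Suppose now that the family `A` with index `i` is larger than its star. The sizes of the other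
families are bounded in terms of `#A` alone. When `#A` lies between the numbers of `a`-sets
meeting an `m`-set and meeting an `(m + 1)`-set, Kruskal–Katona together with the local LYM
inequality shows that the size of each other family is at most the linear interpolation between
the numbers of sets containing an `m`-set and containing an `(m + 1)`-set
(`CrossIntersecting.card_interpolation`). The break points in `#A` are the same for all the other
families, so the inequalities can be added, and the total is bounded by a piecewise linear
function of `#A`. Its slopes strictly increase (`meetContainBound_ratio`), so the maximum is at an
end (`card_add_sum_card_le`): either at `m = 1`, which is the stars, or at `m = k last`, which is
the family of sets meeting a `k last`-set `T` together with the families of sets containing `T`.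
When there are at least three families and `k i` adds up to `n` with every other uniformity, the
slopes are constant and negative, and the stars win. Taking `k i` as large as possible is best at
`m = k last`, because the number of `k`-sets that meet `T` without containing it does not decrease
from `k = k i` to `k = k first` (`choose_meeting_mono`).

There remains the possibility that `A` is even larger than the family of sets meeting a
`k last`-set. Then `i` is the only index of the smallest uniformity, the other families are smaller
than the families of sets containing a `k last`-set, and the two-family bound
`CrossIntersecting.card_add_card_le` for the indices `i` and `first` gives a strictly smaller total
(`sum_card_lt_of_very_large`). Two families with `n = k first + k second` are treated directly by
passing to complements.
-/

open scoped FinsetFamily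

/-! ### The local LYM inequality for iterated shadows -/

/-- A family of `r`-subsets of `V` that is closed under passing to an `r`-subset sharing all but
one element is empty or consists of all `r`-subsets of `V`. -/
lemma mem_of_closed_under_exchange {α : Type*} [DecidableEq α] {S : Finset (Finset α)}
    {V : Finset α} {r : ℕ} (hS : S ⊆ powersetCard r V)
    (hex : ∀ F ∈ S, ∀ x ∈ F, ∀ y ∈ V, y ∉ F → insert y (F.erase x) ∈ S) :
    ∀ (m : ℕ), ∀ F ∈ S, ∀ H ∈ powersetCard r V, #(H \ F) = m → H ∈ S := by
  intro m
  induction m with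
  | zero =>
    intro F hF H hH hm
    have hsub : H ⊆ F := by rwa [card_eq_zero, sdiff_eq_empty_iff_subset] at hm
    have := eq_of_subset_of_card_le hsub
      (by rw [(mem_powersetCard.1 hH).2, (mem_powersetCard.1 (hS hF)).2])
    rwa [this]
  | succ m ih =>
    intro F hF H hH hm
    have hFr := (mem_powersetCard.1 (hS hF)).2
    have hHr := (mem_powersetCard.1 hH).2
    have h1 : #(H \ F) = #(F \ H) := card_sdiff_comm (by rw [hFr, hHr])
    obtain ⟨y, hy⟩ : (H \ F).Nonempty := card_pos.1 (by lia)
    obtain ⟨x, hx⟩ : (F \ H).Nonempty := card_pos.1 (by lia)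
    rw [mem_sdiff] at hx hy
    refine ih _ (hex F hF x hx.1 y ((mem_powersetCard.1 hH).1 hy.1) hy.2) H hH ?_
    have : H \ insert y (F.erase x) = (H \ F).erase y := by
      ext z
      simp only [mem_sdiff, mem_insert, mem_erase]
      constructor
      · rintro ⟨hz, hz'⟩
        refine ⟨fun h => hz' (Or.inl h), hz, fun h => hz' (Or.inr ⟨?_, h⟩)⟩
        rintro rfl
        exact hx.2 hz
      · rintro ⟨hz, hz', h3⟩
        exact ⟨hz', fun h => h.elim hz (fun h => h3 h.2)⟩
    rw [this, card_erase_of_mem (by simpa using hy), hm]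
    rfl

section LYM

variable {α : Type*} [DecidableEq α] {S : Finset (Finset α)} {V : Finset α} {r l : ℕ}

lemma mem_shadow_iterate_sub (hS : S ⊆ powersetCard r V) (hl : l ≤ r) {G : Finset α} :
    G ∈ ∂^[r - l] S ↔ #G = l ∧ ∃ F ∈ S, G ⊆ F := by
  rw [mem_shadow_iterate_iff_exists_mem_card_add]
  constructor
  · rintro ⟨F, hF, hGF, hc⟩
    have := (mem_powersetCard.1 (hS hF)).2
    exact ⟨by lia, F, hF, hGF⟩
  · rintro ⟨hG, F, hF, hGF⟩
    have := (mem_powersetCard.1 (hS hF)).2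
    exact ⟨F, hF, hGF, by lia⟩

lemma card_filter_superset_powersetCard {G : Finset α} (hG : G ⊆ V) (hr : #G ≤ r) :
    #{F ∈ powersetCard r V | G ⊆ F} = (#V - #G).choose (r - #G) := by
  rw [← card_sdiff_of_subset hG, ← card_powersetCard]
  refine card_bij' (fun F _ => F \ G) (fun F _ => F ∪ G) ?_ ?_ ?_ ?_
  · intro F hF
    simp only [mem_filter, mem_powersetCard] at hF ⊢
    refine ⟨sdiff_subset_sdiff hF.1.1 le_rfl, ?_⟩
    rw [card_sdiff_of_subset hF.2, hF.1.2]
  · intro F hF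
    simp only [mem_filter, mem_powersetCard] at hF ⊢
    refine ⟨⟨union_subset (hF.1.trans sdiff_subset) hG, ?_⟩, subset_union_right⟩
    rw [card_union_of_disjoint (disjoint_of_subset_left hF.1 sdiff_disjoint), hF.2]
    lia
  · intro F hF
    simp only [mem_filter] at hF
    simp [hF.2]
  · intro F hF
    simp only [mem_powersetCard] at hF
    rw [union_sdiff_right]
    exact sdiff_eq_self_of_disjoint (disjoint_of_subset_left hF.1 sdiff_disjoint)

lemma card_filter_subset_shadow (hS : S ⊆ powersetCard r V) (hl : l ≤ r) {F : Finset α}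
    (hF : F ∈ S) : #{G ∈ ∂^[r - l] S | G ⊆ F} = r.choose l := by
  rw [← (mem_powersetCard.1 (hS hF)).2, ← card_powersetCard, (mem_powersetCard.1 (hS hF)).2]
  congr 1
  ext G
  simp only [mem_filter, mem_shadow_iterate_sub hS hl, mem_powersetCard]
  exact ⟨fun h => ⟨h.2, h.1.1⟩, fun h => ⟨⟨h.2, F, hF, h.1⟩, h.1⟩⟩

lemma card_filter_superset_le (hS : S ⊆ powersetCard r V) (hl : l ≤ r) {G : Finset α}
    (hG : G ∈ ∂^[r - l] S) : #{F ∈ S | G ⊆ F} ≤ (#V - l).choose (r - l) := by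
  obtain ⟨rfl, F, hF, hGF⟩ := (mem_shadow_iterate_sub hS hl).1 hG
  rw [← card_filter_superset_powersetCard (hGF.trans (mem_powersetCard.1 (hS hF)).1) hl]
  exact card_le_card (filter_subset_filter _ hS)

lemma shadow_density_aux {s t : ℕ} (hl : l ≤ r) {N : ℕ} (hr : r ≤ N) :
    (s * r.choose l ≤ t * (N - l).choose (r - l) ↔ s * N.choose l ≤ t * N.choose r) ∧
    (s * r.choose l < t * (N - l).choose (r - l) ↔ s * N.choose l < t * N.choose r) := by
  have h := Nat.choose_mul (n := N) (k := r) (s := l) hl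
  have h1 : 0 < N.choose l := Nat.choose_pos (hl.trans hr)
  have h2 : 0 < r.choose l := Nat.choose_pos hl
  constructor
  · rw [← Nat.mul_le_mul_right_iff h1, ← Nat.mul_le_mul_right_iff (n := s * N.choose l) h2]
    have e1 : s * r.choose l * N.choose l = s * N.choose l * r.choose l := by ring
    have e2 : t * (N - l).choose (r - l) * N.choose l = t * N.choose r * r.choose l := by
      rw [mul_assoc t (N.choose r), h]; ring
    rw [e1, e2]
  · rw [← Nat.mul_lt_mul_right h1, ← Nat.mul_lt_mul_right (b := s * N.choose l) h2]
    have e1 : s * r.choose l * N.choose l = s * N.choose l * r.choose l := by ring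
    have e2 : t * (N - l).choose (r - l) * N.choose l = t * N.choose r * r.choose l := by
      rw [mul_assoc t (N.choose r), h]; ring
    rw [e1, e2]

/-- The local LYM inequality for iterated shadows: the density of a family of `r`-subsets of `V`
is at most that of its shadow on level `l`. -/
lemma shadow_density_le (hS : S ⊆ powersetCard r V) (hl : l ≤ r) :
    #S * (#V).choose l ≤ #(∂^[r - l] S) * (#V).choose r := by
  rcases S.eq_empty_or_nonempty with rfl | ⟨F, hF⟩
  · simp
  have hr : r ≤ #V := by
    have := mem_powersetCard.1 (hS hF)
    rw [← this.2]; exact card_le_card this.1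
  rw [← (shadow_density_aux hl hr).1]
  refine card_mul_le_card_mul (fun F G : Finset α => G ⊆ F) ?_ ?_
  · intro F hF
    exact (card_filter_subset_shadow hS hl hF).ge
  · intro G hG
    exact card_filter_superset_le hS hl hG

/-- The local LYM inequality is strict unless the family is empty or a full level. -/
lemma shadow_density_lt (hS : S ⊆ powersetCard r V) (hl : l < r) (h0 : 0 < #S)
    (h1 : #S < (#V).choose r) :
    #S * (#V).choose l < #(∂^[r - l] S) * (#V).choose r := by
  obtain ⟨F₀, hF₀⟩ := card_pos.1 h0
  have hr : r ≤ #V := by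
    have := mem_powersetCard.1 (hS hF₀)
    rw [← this.2]; exact card_le_card this.1
  rw [← (shadow_density_aux hl.le hr).2]
  -- A member of the shadow, some `r`-superset of which lies outside `S`.
  obtain ⟨G, hG, H, hH, hGH, hHS⟩ : ∃ G ∈ ∂^[r - l] S, ∃ H ∈ powersetCard r V, G ⊆ H ∧ H ∉ S := by
    by_contra! hcon
    have hall : powersetCard r V ⊆ S := by
      intro H hH
      refine mem_of_closed_under_exchange hS ?_ _ F₀ hF₀ H hH rfl
      intro F hF x hx y hy hyF
      have hFc := mem_powersetCard.1 (hS hF)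
      obtain ⟨G, hGs, hGc⟩ := exists_subset_card_eq
        (show l ≤ #(F.erase x) by rw [card_erase_of_mem hx]; lia)
      refine hcon G ((mem_shadow_iterate_sub hS hl.le).2
        ⟨hGc, F, hF, hGs.trans (erase_subset _ _)⟩) _ ?_ (hGs.trans (subset_insert _ _))
      rw [mem_powersetCard]
      refine ⟨insert_subset hy ((erase_subset _ _).trans hFc.1), ?_⟩
      rw [card_insert_of_notMem (fun h => hyF (mem_of_mem_erase h)), card_erase_of_mem hx]
      lia
    have := card_le_card hall
    rw [card_powersetCard] at this
    lia
  have hsum := sum_card_bipartiteAbove_eq_sum_card_bipartiteBelow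
    (s := S) (t := ∂^[r - l] S) (fun F G : Finset α => G ⊆ F)
  have hL : ∑ F ∈ S, #((∂^[r - l] S).bipartiteAbove (fun F G : Finset α => G ⊆ F) F)
      = #S * r.choose l := by
    rw [← smul_eq_mul, ← sum_const]
    exact sum_congr rfl fun F hF => card_filter_subset_shadow hS hl.le hF
  rw [← hL, hsum, ← smul_eq_mul, ← sum_const]
  refine sum_lt_sum (fun G hG => card_filter_superset_le hS hl.le hG) ⟨G, hG, ?_⟩
  obtain ⟨rfl, F, hF, hGF⟩ := (mem_shadow_iterate_sub hS hl.le).1 hG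
  rw [← card_filter_superset_powersetCard (hGF.trans (mem_powersetCard.1 (hS hF)).1) hl.le]
  refine card_lt_card ⟨filter_subset_filter _ hS, fun h => hHS ?_⟩
  exact (mem_filter.1 (h (mem_filter.2 ⟨hH, hGH⟩))).1

end LYM

/-! ### Chord forms of the Kruskal–Katona theorem -/

section Segments

variable {n : ℕ}

/-- There is an initial segment of colex of every size. -/
lemma exists_isInitSeg_card (r s : ℕ) (hs : s ≤ n.choose r) :
    ∃ C : Finset (Finset (Fin n)), Colex.IsInitSeg C r ∧ #C = s := by
  obtain ⟨d, hd⟩ := Nat.exists_eq_add_of_le hs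
  induction d generalizing s with
  | zero =>
    refine ⟨powersetCard r univ, ⟨Set.sized_powersetCard _ _, ?_⟩, by simp [hd]⟩
    intro s t _ ht
    simp [ht.2]
  | succ d ih =>
    obtain ⟨C, hC, hCs⟩ := ih (s + 1) (by lia) (by lia)
    obtain ⟨M, hM, hmax⟩ := exists_max_image C (fun F => toColex F) (card_pos.1 (by lia))
    refine ⟨C.erase M, ⟨fun F hF => hC.1 (mem_of_mem_erase hF), ?_⟩, ?_⟩
    · intro F G hF hG
      have hFC := mem_of_mem_erase hF
      refine mem_erase.2 ⟨?_, hC.2 hFC hG⟩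
      rintro rfl
      exact absurd hG.1 (not_lt.2 (hmax F hFC))
    · rw [card_erase_of_mem hM, hCs]; rfl

/-- The first `N` points of `Fin n`. -/
def firstPoints (n N : ℕ) : Finset (Fin n) := {x | x.val < N}

lemma mem_firstPoints {N : ℕ} {x : Fin n} : x ∈ firstPoints n N ↔ x.val < N := by
  simp [firstPoints]

lemma card_firstPoints {N : ℕ} (h : N ≤ n) : #(firstPoints n N) = N := by
  rw [firstPoints, Fin.card_filter_val_lt]
  exact min_eq_right h

lemma isInitSeg_powersetCard_firstPoints (N r : ℕ) :
    Colex.IsInitSeg (powersetCard r (firstPoints n N)) r := by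
  refine ⟨Set.sized_powersetCard _ _, ?_⟩
  intro F G hF hG
  rw [mem_powersetCard] at hF ⊢
  refine ⟨fun x hx => ?_, hG.2⟩
  rw [mem_firstPoints]
  by_contra hxN
  have h1 : ∀ a ∈ F, a < x := fun a ha => by
    have := mem_firstPoints.1 (hF.1 ha)
    exact Fin.lt_def.2 (by lia)
  obtain ⟨a, ha, haG, hmax⟩ := Colex.toColex_le_toColex.1 hG.1.le hx
    (fun h => absurd (h1 x h) (lt_irrefl _))
  exact absurd (h1 a ha) (not_lt.2 hmax)

lemma initSeg_subset_of_card_le {N r : ℕ} (hN : N ≤ n) {C : Finset (Finset (Fin n))}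
    (hC : Colex.IsInitSeg C r) (h : #C ≤ N.choose r) : C ⊆ powersetCard r (firstPoints n N) := by
  obtain h' | h' := hC.total (isInitSeg_powersetCard_firstPoints N r)
  · exact h'
  · exact (eq_of_subset_of_card_le h' (by simpa [card_firstPoints hN] using h)).ge

lemma subset_initSeg_of_card_le {N r : ℕ} (hN : N ≤ n) {C : Finset (Finset (Fin n))}
    (hC : Colex.IsInitSeg C r) (h : N.choose r ≤ #C) : powersetCard r (firstPoints n N) ⊆ C := by
  obtain h' | h' := hC.total (isInitSeg_powersetCard_firstPoints N r)
  · exact (eq_of_subset_of_card_le h' (by simpa [card_firstPoints hN] using h)).ge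
  · exact h'

variable {S : Finset (Finset (Fin n))} {r : ℕ}

/-- Chord form of the Kruskal–Katona theorem between `0` and `binom(N, r)`. -/
lemma shadow_chord_zero {N l : ℕ} (hS : (S : Set (Finset (Fin n))).Sized r) (hN : N ≤ n)
    (hl : l ≤ r) (hc : #S ≤ N.choose r) :
    #S * N.choose l ≤ #(∂^[r - l] S) * N.choose r ∧
    (l < r → 0 < #S → #S < N.choose r → #S * N.choose l < #(∂^[r - l] S) * N.choose r) := by
  obtain ⟨C, hC, hCs⟩ := exists_isInitSeg_card (n := n) r #S
    (hc.trans (Nat.choose_le_choose r hN))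
  have hCV := initSeg_subset_of_card_le hN hC (hCs.le.trans hc)
  have hkk : #(∂^[r - l] C) ≤ #(∂^[r - l] S) := iterated_kk hS hCs.le hC
  have hV := card_firstPoints (n := n) hN
  constructor
  · have := shadow_density_le hCV hl
    rw [hV, hCs] at this
    exact this.trans (Nat.mul_le_mul_right _ hkk)
  · intro hl h0 h1
    have := shadow_density_lt hCV hl (by lia) (by rw [hV]; lia)
    rw [hV, hCs] at this
    exact this.trans_le (Nat.mul_le_mul_right _ hkk)

/-- Chord form of the Kruskal–Katona theorem between `binom(N, r)` and `binom(N + 1, r)`: the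
minimal shadow, as a function of the size, lies above the chord, strictly so inside. -/
lemma shadow_chord {N a z : ℕ} (hS : (S : Set (Finset (Fin n))).Sized r) (hN : N < n)
    (ha : 1 ≤ a) (har : a ≤ r) (hrN : r ≤ N) (hz : z ≤ N.choose (r - 1))
    (hc : N.choose r + z ≤ #S) :
    N.choose a * N.choose (r - 1) + z * N.choose (a - 1)
      ≤ #(∂^[r - a] S) * N.choose (r - 1) ∧
    (a < r → 0 < z → z < N.choose (r - 1) →
      N.choose a * N.choose (r - 1) + z * N.choose (a - 1)
        < #(∂^[r - a] S) * N.choose (r - 1)) := by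
  have hNr : N.choose r + z ≤ (N + 1).choose r := by
    obtain ⟨r, rfl⟩ : ∃ q, r = q + 1 := ⟨r - 1, by lia⟩
    rw [Nat.choose_succ_succ]
    simp only [Nat.add_sub_cancel] at hz
    lia
  obtain ⟨C, hC, hCs⟩ := exists_isInitSeg_card (n := n) r (N.choose r + z)
    (hNr.trans (Nat.choose_le_choose r hN))
  have hkk : #(∂^[r - a] C) ≤ #(∂^[r - a] S) := iterated_kk hS (by lia) hC
  set V := firstPoints n N with hVdef
  have hV : #V = N := card_firstPoints hN.le
  have hVC : powersetCard r V ⊆ C := subset_initSeg_of_card_le hN.le hC (by lia)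
  have hCV : C ⊆ powersetCard r (firstPoints n (N + 1)) :=
    initSeg_subset_of_card_le hN hC (by lia)
  set v : Fin n := ⟨N, hN⟩ with hv
  have hvV : v ∉ V := by simp [hVdef, mem_firstPoints, hv]
  have hins : firstPoints n (N + 1) = insert v V := by
    ext x
    simp only [mem_insert, hVdef, mem_firstPoints, hv, Fin.ext_iff]
    lia
  rw [hins] at hCV
  -- The link of the last point `v`.
  set D : Finset (Finset (Fin n)) := {F ∈ powersetCard (r - 1) V | insert v F ∈ C} with hD
  have hDV : D ⊆ powersetCard (r - 1) V := filter_subset _ _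
  have hDc : #D = z := by
    have h1 : C \ powersetCard r V = D.image (insert v) := by
      ext F
      simp only [mem_sdiff, mem_image, hD, mem_filter, mem_powersetCard]
      constructor
      · rintro ⟨hF, hF'⟩
        have hFc := mem_powersetCard.1 (hCV hF)
        have hvF : v ∈ F := by
          by_contra hvF
          exact hF' ⟨(subset_insert_iff_of_notMem hvF).1 hFc.1, hFc.2⟩
        refine ⟨F.erase v, ⟨⟨subset_insert_iff.1 hFc.1, ?_⟩, ?_⟩, insert_erase hvF⟩
        · rw [card_erase_of_mem hvF, hFc.2]
        · rwa [insert_erase hvF]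
      · rintro ⟨G, ⟨hG, hGC⟩, rfl⟩
        exact ⟨hGC, fun h => hvV (h.1 (mem_insert_self _ _))⟩
    have h2 : #(D.image (insert v)) = #D := by
      refine card_image_of_injOn ?_
      intro F hF G hG hFG
      have hF' := fun h => hvV ((mem_powersetCard.1 (hDV hF)).1 h)
      have hG' := fun h => hvV ((mem_powersetCard.1 (hDV hG)).1 h)
      rw [← erase_insert hF', ← erase_insert hG']
      exact congrArg (fun X => erase X v) hFG
    rw [← h2, ← h1, card_sdiff_of_subset hVC, card_powersetCard, hV, hCs]
    lia
  have hCU : C ⊆ powersetCard r (insert v V) := hCV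
  have hsh : N.choose a + #(∂^[r - a] D) ≤ #(∂^[r - a] C) := by
    have hra : r - a = (r - 1) - (a - 1) := by lia
    have hDs : ∀ G, G ∈ ∂^[r - a] D ↔ #G = a - 1 ∧ ∃ F ∈ D, G ⊆ F := fun G => by
      rw [hra]; exact mem_shadow_iterate_sub hDV (by lia)
    have hvD : ∀ G ∈ ∂^[r - a] D, v ∉ G := by
      intro G hG h
      obtain ⟨-, F, hF, hGF⟩ := (hDs G).1 hG
      exact hvV ((mem_powersetCard.1 (hDV hF)).1 (hGF h))
    have h2 : #((∂^[r - a] D).image (insert v)) = #(∂^[r - a] D) := by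
      refine card_image_of_injOn ?_
      intro F hF G hG hFG
      rw [← erase_insert (hvD F hF), ← erase_insert (hvD G hG)]
      exact congrArg (fun X => erase X v) hFG
    rw [← h2, ← hV, ← card_powersetCard, ← card_union_of_disjoint]
    · refine card_le_card (union_subset ?_ ?_)
      · intro G hG
        rw [mem_powersetCard] at hG
        obtain ⟨F, hGF, hFV, hFc⟩ := exists_subsuperset_card_eq hG.1 (hG.2.le.trans har)
          (hrN.trans hV.ge)
        exact (mem_shadow_iterate_sub hCU har).2
          ⟨hG.2, F, hVC (mem_powersetCard.2 ⟨hFV, hFc⟩), hGF⟩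
      · intro G hG
        obtain ⟨G, hG', rfl⟩ := mem_image.1 hG
        obtain ⟨hGc, F, hF, hGF⟩ := (hDs G).1 hG'
        refine (mem_shadow_iterate_sub hCU har).2 ⟨?_, insert v F, (mem_filter.1 hF).2,
          insert_subset_insert _ hGF⟩
        rw [card_insert_of_notMem (hvD G hG'), hGc]
        lia
    · rw [disjoint_left]
      intro G hG hG'
      obtain ⟨H, hH, rfl⟩ := mem_image.1 hG'
      exact hvV ((mem_powersetCard.1 hG).1 (mem_insert_self _ _))
  have hra : r - a = (r - 1) - (a - 1) := by lia
  have hmul := Nat.mul_le_mul_right (N.choose (r - 1)) (hsh.trans hkk)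
  rw [add_mul] at hmul
  constructor
  · have := shadow_density_le hDV (show a - 1 ≤ r - 1 by lia)
    rw [hV, hDc, ← hra] at this
    lia
  · intro har h0 h1
    have := shadow_density_lt hDV (show a - 1 < r - 1 by lia) (by lia) (by rw [hV]; lia)
    rw [hV, hDc, ← hra] at this
    lia

end Segments

/-! ### The equality case of Kruskal–Katona -/

/-- Equality case of the Kruskal–Katona theorem at `binom(n - 1, r)`: a family of `r`-sets of
this size with minimal shadow on level `a` has a point lying in none of its members. Such a point
is any `v` of less than average degree: the shadow is at least that of the family of members
avoiding `v` plus that of the link of `v`, and the chord bounds for these two add up to more than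
`binom(n - 1, a)` unless the link is empty. -/
lemma exists_forall_notMem_of_card_shadow_le {n r a : ℕ} {S : Finset (Finset (Fin n))}
    (hS : (S : Set (Finset (Fin n))).Sized r) (ha : 1 ≤ a) (har : a < r) (hr : r + 1 ≤ n)
    (hcard : #S = (n - 1).choose r) (hsh : #(∂^[r - a] S) ≤ (n - 1).choose a) :
    ∃ v, ∀ F ∈ S, v ∉ F := by
  rcases hr.eq_or_lt with hr | hr
  · have h1 : #S = 1 := by rw [hcard, ← hr]; simp
    obtain ⟨F, rfl⟩ := card_eq_one.1 h1
    have hF : #F = r := hS (by simp)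
    obtain ⟨v, -, hv⟩ := exists_mem_notMem_of_card_lt_card
      (show #F < #(univ : Finset (Fin n)) by simp; lia)
    exact ⟨v, by simpa using hv⟩
  obtain ⟨N, rfl⟩ : ∃ N, n = N + 2 := ⟨n - 2, by lia⟩
  obtain ⟨q, rfl⟩ : ∃ q, r = q + 1 := ⟨r - 1, by lia⟩
  obtain ⟨b, rfl⟩ : ∃ b, a = b + 1 := ⟨a - 1, by lia⟩
  simp only [show N + 2 - 1 = N + 1 from rfl] at hcard hsh
  have hSu : S ⊆ powersetCard (q + 1) univ := fun F hF => by simpa using hS hF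
  obtain ⟨v, hv⟩ : ∃ v, #{F ∈ S | v ∈ F} < N.choose q := by
    by_contra! hcon
    have h1 : ∑ F ∈ S, #F = ∑ v : Fin (N + 2), #{F ∈ S | v ∈ F} := by
      have := sum_card_bipartiteAbove_eq_sum_card_bipartiteBelow
        (s := S) (t := (univ : Finset (Fin (N + 2)))) (fun F v => v ∈ F)
      simpa [bipartiteAbove, bipartiteBelow] using this
    have h2 : ∑ F ∈ S, #F = #S * (q + 1) := by
      rw [← smul_eq_mul, ← sum_const]
      exact sum_congr rfl fun F hF => hS hF
    have h3 : (N + 2) * N.choose q ≤ ∑ v : Fin (N + 2), #{F ∈ S | v ∈ F} := by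
      have := card_nsmul_le_sum univ (fun v : Fin (N + 2) => #{F ∈ S | v ∈ F}) (N.choose q)
        (fun v _ => hcon v)
      simpa using this
    have h4 := Nat.add_one_mul_choose_eq N q
    have h5 : 0 < N.choose q := Nat.choose_pos (by lia)
    rw [hcard] at h2
    nlinarith
  refine ⟨v, ?_⟩
  set D : Finset (Finset (Fin (N + 2))) := ({F ∈ S | v ∈ F}).image (fun F => F.erase v) with hD
  set E : Finset (Finset (Fin (N + 2))) := {F ∈ S | v ∉ F} with hE
  have hDc : #D = #{F ∈ S | v ∈ F} := by
    refine card_image_of_injOn ?_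
    intro F hF G hG hFG
    have hF' := (mem_filter.1 hF).2
    have hG' := (mem_filter.1 hG).2
    rw [← insert_erase hF', ← insert_erase hG']
    exact congrArg (insert v) hFG
  have hDE : #D + #E = (N + 1).choose (q + 1) := by
    rw [hDc, hE, ← hcard]
    exact card_filter_add_card_filter_not _
  have hDs : (D : Set (Finset (Fin (N + 2)))).Sized q := by
    intro G hG
    obtain ⟨F, hF, rfl⟩ := mem_image.1 hG
    rw [card_erase_of_mem (mem_filter.1 hF).2, hS (mem_filter.1 hF).1]
    rfl
  have hEs : (E : Set (Finset (Fin (N + 2)))).Sized (q + 1) := fun F hF => hS (mem_filter.1 hF).1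
  have hDu : D ⊆ powersetCard q univ := fun F hF => by simpa using hDs hF
  have hEu : E ⊆ powersetCard (q + 1) univ := (filter_subset _ _).trans hSu
  have hsum : #(∂^[q - b] D) + #(∂^[q - b] E) ≤ #(∂^[q + 1 - (b + 1)] S) := by
    have hDm : ∀ G, G ∈ ∂^[q - b] D ↔ #G = b ∧ ∃ F ∈ D, G ⊆ F := fun G =>
      mem_shadow_iterate_sub hDu (by lia)
    have hEm : ∀ G, G ∈ ∂^[q - b] E ↔ #G = b + 1 ∧ ∃ F ∈ E, G ⊆ F := fun G => by
      rw [show q - b = q + 1 - (b + 1) by lia]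
      exact mem_shadow_iterate_sub hEu (by lia)
    have hvD : ∀ G ∈ ∂^[q - b] D, v ∉ G := by
      intro G hG h
      obtain ⟨-, F, hF, hGF⟩ := (hDm G).1 hG
      obtain ⟨F, -, rfl⟩ := mem_image.1 hF
      exact notMem_erase _ _ (hGF h)
    have h2 : #((∂^[q - b] D).image (insert v)) = #(∂^[q - b] D) := by
      refine card_image_of_injOn ?_
      intro F hF G hG hFG
      rw [← erase_insert (hvD F hF), ← erase_insert (hvD G hG)]
      exact congrArg (fun X => erase X v) hFG
    rw [← h2, ← card_union_of_disjoint]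
    · refine card_le_card (union_subset ?_ ?_)
      · intro G hG
        obtain ⟨G, hG', rfl⟩ := mem_image.1 hG
        obtain ⟨hGc, H, hH, hGH⟩ := (hDm G).1 hG'
        obtain ⟨F, hF, rfl⟩ := mem_image.1 hH
        refine (mem_shadow_iterate_sub hSu har.le).2 ⟨?_, F, (mem_filter.1 hF).1, ?_⟩
        · rw [card_insert_of_notMem (hvD G hG'), hGc]
        · exact insert_subset (mem_filter.1 hF).2 (hGH.trans (erase_subset _ _))
      · intro G hG
        obtain ⟨hGc, F, hF, hGF⟩ := (hEm G).1 hG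
        exact (mem_shadow_iterate_sub hSu har.le).2 ⟨hGc, F, (mem_filter.1 hF).1, hGF⟩
    · rw [disjoint_left]
      intro G hG hG'
      obtain ⟨H, -, rfl⟩ := mem_image.1 hG
      obtain ⟨-, F, hF, hGF⟩ := (hEm _).1 hG'
      exact (mem_filter.1 hF).2 (hGF (mem_insert_self _ _))
  have hP := Nat.choose_succ_succ N q
  have hP' := Nat.choose_succ_succ N b
  have hlink := shadow_chord_zero (N := N) (l := b) hDs (by lia) (by lia) (by lia)
  have hdel := (shadow_chord (N := N) (a := b + 1) (z := N.choose q - #D) hEs (by lia) ha har.le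
    (by lia) (by simp) (by lia)).1
  simp only [Nat.add_sub_cancel, Nat.add_sub_add_right] at hdel
  have hpos : 0 < N.choose q := Nat.choose_pos (by lia)
  have hD0 : #D = 0 := by
    by_contra hne
    have hlt := hlink.2 (by lia) (by lia) (by lia)
    have hle : #(∂^[q - b] D) + #(∂^[q - b] E) ≤ (N + 1).choose (b + 1) := hsum.trans hsh
    have hmul := Nat.mul_le_mul_right (N.choose q) hle
    rw [hP', add_mul] at hmul
    have hz : (N.choose q - #D) * N.choose b + #D * N.choose b = N.choose q * N.choose b := by
      rw [← add_mul, Nat.sub_add_cancel (by lia)]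
    rw [Nat.succ_eq_add_one] at hmul
    nlinarith
  intro F hF hvF
  rw [hDc, card_eq_zero] at hD0
  have : F ∈ ({F ∈ S | v ∈ F} : Finset _) := mem_filter.2 ⟨hF, hvF⟩
  rw [hD0] at this
  simp at this

/-! ### Pairs of cross-intersecting families -/

section Families

variable {n : ℕ} {k : ℕ} {T : Finset (Fin n)}

lemma mem_kSubsets {F : Finset (Fin n)} : F ∈ kSubsets n k ↔ #F = k := by
  simp [kSubsets]

lemma card_kSubsets : #(kSubsets n k) = n.choose k := by
  simp [kSubsets]

lemma mem_meetingFamily {F : Finset (Fin n)} :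
    F ∈ meetingFamily k T ↔ #F = k ∧ (F ∩ T).Nonempty := by
  simp [meetingFamily, mem_kSubsets]

lemma mem_containingFamily {F : Finset (Fin n)} :
    F ∈ containingFamily k T ↔ #F = k ∧ T ⊆ F := by
  simp [containingFamily, mem_kSubsets]

lemma fullStar_eq_containingFamily (v : Fin n) : fullStar k v = containingFamily k {v} := by
  ext F; simp [fullStar, containingFamily]

lemma fullStar_eq_meetingFamily (v : Fin n) : fullStar k v = meetingFamily k {v} := by
  ext F
  simp only [fullStar, meetingFamily, mem_filter, and_congr_right_iff]
  intro _
  constructor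
  · intro h; exact ⟨v, by simpa using h⟩
  · rintro ⟨x, hx⟩
    rw [mem_inter, mem_singleton] at hx
    exact hx.2 ▸ hx.1

lemma card_containingFamily (h : #T ≤ k) : #(containingFamily k T) = (n - #T).choose (k - #T) := by
  have := card_filter_superset_powersetCard (subset_univ T) h
  simpa [containingFamily, kSubsets] using this

lemma card_fullStar (hk : 1 ≤ k) (v : Fin n) : #(fullStar k v) = (n - 1).choose (k - 1) := by
  rw [fullStar_eq_containingFamily, card_containingFamily (by simpa using hk)]
  simp

lemma card_meetingFamily_add : #(meetingFamily k T) + (n - #T).choose k = n.choose k := by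
  rw [← card_kSubsets (n := n) (k := k), meetingFamily,
    ← card_filter_add_card_filter_not (s := kSubsets n k) (fun F => (F ∩ T).Nonempty)]
  congr 1
  have : (n - #T).choose k = #(powersetCard k Tᶜ) := by simp [card_compl]
  rw [this]
  congr 1
  ext F
  simp only [mem_powersetCard, mem_filter, mem_kSubsets, not_nonempty_iff_eq_empty,
    ← disjoint_iff_inter_eq_empty, subset_compl_iff_disjoint_right, and_comm]

variable {a b : ℕ} {A B : Finset (Finset (Fin n))}

lemma CrossIntersecting.symm (h : CrossIntersecting A B) : CrossIntersecting B A :=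
  fun F hF G hG => by rw [inter_comm]; exact h G hG F hF

lemma CrossIntersecting.subset_meetingFamily (h : CrossIntersecting A B) (hA : A ⊆ kSubsets n a)
    (hT : T ∈ B) : A ⊆ meetingFamily a T := fun F hF =>
  mem_meetingFamily.2 ⟨mem_kSubsets.1 (hA hF), h F hF T hT⟩

/-- A `b`-set that misses a point `x` of `T` is disjoint from some `a`-set containing `x`. -/
lemma CrossIntersecting.subset_containingFamily (h : CrossIntersecting (meetingFamily a T) B)
    (hB : B ⊆ kSubsets n b) (ha : 1 ≤ a) (hab : a + b ≤ n) : B ⊆ containingFamily b T := by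
  intro F hF
  have hFc := mem_kSubsets.1 (hB hF)
  refine mem_containingFamily.2 ⟨hFc, fun x hx => ?_⟩
  by_contra hxF
  obtain ⟨G, hxG, hGF, hG⟩ := exists_subsuperset_card_eq (s := {x}) (t := Fᶜ) (n := a)
    (by simpa using hxF) (by simpa using ha) (by rw [card_compl, Fintype.card_fin]; lia)
  have hxG' : x ∈ G := hxG (mem_singleton_self x)
  obtain ⟨y, hy⟩ := h G (mem_meetingFamily.2 ⟨hG, x, mem_inter.2 ⟨hxG', hx⟩⟩) F hF
  rw [mem_inter] at hy
  exact (mem_compl.1 (hGF hy.1)) hy.2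

/-- The members of `A` avoid the shadow of the family of complements of members of `B`. -/
lemma CrossIntersecting.card_add_card_shadow_le (h : CrossIntersecting A B)
    (hA : A ⊆ kSubsets n a) (hB : B ⊆ kSubsets n b) (hab : a + b ≤ n) :
    #A + #(∂^[n - b - a] Bᶜˢ) ≤ n.choose a := by
  have hBu : Bᶜˢ ⊆ powersetCard (n - b) univ := by
    intro F hF
    have := mem_kSubsets.1 (hB (mem_compls.1 hF))
    rw [card_compl, Fintype.card_fin] at this
    have h2 := card_le_univ F
    rw [Fintype.card_fin] at h2
    simp only [mem_powersetCard, subset_univ, true_and]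
    lia
  have hm : ∀ G, G ∈ ∂^[n - b - a] Bᶜˢ ↔ #G = a ∧ ∃ F ∈ Bᶜˢ, G ⊆ F := fun G =>
    mem_shadow_iterate_sub hBu (by lia)
  rw [← card_kSubsets, ← card_union_of_disjoint]
  · refine card_le_card (union_subset hA fun G hG => mem_kSubsets.2 ((hm G).1 hG).1)
  · rw [disjoint_left]
    intro G hG hG'
    obtain ⟨-, F, hF, hGF⟩ := (hm G).1 hG'
    obtain ⟨y, hy⟩ := h G hG _ (mem_compls.1 hF)
    rw [mem_inter, mem_compl] at hy
    exact hy.2 (hGF hy.1)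

lemma sized_compls_of_subset_kSubsets (hB : B ⊆ kSubsets n b) :
    (Bᶜˢ : Set (Finset (Fin n))).Sized (n - b) := by
  have : (B : Set (Finset (Fin n))).Sized b := fun F hF => mem_kSubsets.1 (hB hF)
  simpa using this.compls

/-- If `B` has at least as many members as the family of `b`-sets containing an `m`-set, then `A`
has at most as many members as the family of `a`-sets meeting an `m`-set. -/
lemma CrossIntersecting.card_add_choose_le (h : CrossIntersecting A B)
    (hA : A ⊆ kSubsets n a) (hB : B ⊆ kSubsets n b) (hab : a + b ≤ n) {m : ℕ} (hm : m ≤ b)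
    (hc : (n - m).choose (b - m) ≤ #B) : #A + (n - m).choose a ≤ n.choose a := by
  have h1 := h.card_add_card_shadow_le hA hB hab
  have h2 : (n - m).choose (n - b) ≤ #Bᶜˢ := by
    rw [card_compls, Nat.choose_symm_of_eq_add (show n - m = (n - b) + (b - m) by lia)]
    exact hc
  have h3 := kruskal_katona_lovasz_form (i := n - b - a) (by lia) (show n - b ≤ n - m by lia)
    (by lia) (sized_compls_of_subset_kSubsets hB) h2
  rw [show n - b - (n - b - a) = a by lia] at h3
  lia

/-- If `#A` lies between the numbers of `a`-sets meeting an `m`-set and an `(m + 1)`-set, then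
`#B` lies below the linear interpolation between the numbers of `b`-sets containing an `m`-set and
an `(m + 1)`-set. -/
lemma CrossIntersecting.card_interpolation (h : CrossIntersecting A B)
    (hA : A ⊆ kSubsets n a) (hB : B ⊆ kSubsets n b) (hab : a + b ≤ n) (ha : 1 ≤ a) {m z : ℕ}
    (hm : m < b) (hz : 0 < z) (hzw : z ≤ (n - m - 1).choose (a - 1))
    (hc : n.choose a + z = #A + (n - m).choose a) :
    (n - m - 1).choose (a - 1) * #B + z * (n - m - 1).choose (b - m)
      ≤ (n - m - 1).choose (a - 1) * (n - m).choose (b - m) ∧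
    (z < (n - m - 1).choose (a - 1) → a + b < n →
      (n - m - 1).choose (a - 1) * #B + z * (n - m - 1).choose (b - m)
        < (n - m - 1).choose (a - 1) * (n - m).choose (b - m)) := by
  have h1 := h.card_add_card_shadow_le hA hB hab
  obtain ⟨N, hN⟩ : ∃ N, n - m = N + 1 := ⟨n - m - 1, by lia⟩
  obtain ⟨q, hq⟩ : ∃ q, n - b = q + 1 := ⟨n - b - 1, by lia⟩
  obtain ⟨p, rfl⟩ : ∃ p, a = p + 1 := ⟨a - 1, by lia⟩
  have e1 : (n - m).choose (b - m) = N.choose (q + 1) + N.choose q := by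
    rw [Nat.choose_symm_of_eq_add (show n - m = (b - m) + (n - b) by lia), hN, hq,
      Nat.choose_succ_succ, add_comm]
  have e2 : (n - m - 1).choose (b - m) = N.choose q := by
    rw [hN]
    exact Nat.choose_symm_of_eq_add (by lia)
  have e3 := Nat.choose_succ_succ N p
  rw [Nat.succ_eq_add_one, ← hN] at e3
  rw [e1, e2]
  simp only [hN, Nat.add_sub_cancel] at hzw ⊢
  have hw : 0 < N.choose p := by lia
  have hpos : 0 < N.choose q := Nat.choose_pos (by lia)
  rw [hq] at h1
  set X := #(∂^[q + 1 - (p + 1)] Bᶜˢ) with hX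
  set w := N.choose p
  set c := N.choose q
  have hXz : X + z ≤ w + N.choose (p + 1) := by lia
  rcases le_or_gt #B (N.choose (q + 1)) with hB0 | hB0
  · refine ⟨by nlinarith, fun hzlt _ => by nlinarith⟩
  · have hs := sized_compls_of_subset_kSubsets hB
    rw [hq] at hs
    have hchord := shadow_chord (N := N) (a := p + 1) (z := min (#B - N.choose (q + 1)) c) hs
      (by lia) (by lia) (by lia) (by lia) (min_le_right _ _)
      (by rw [card_compls]; have := min_le_left (#B - N.choose (q + 1)) c; lia)
    simp only [Nat.add_sub_cancel] at hchord
    have hmul := Nat.mul_le_mul_right c hXz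
    have hlt : #B - N.choose (q + 1) < c := by
      by_contra! hge
      rw [min_eq_right hge] at hchord
      have := hchord.1
      linarith [Nat.mul_pos hz hpos]
    rw [min_eq_left hlt.le] at hchord
    obtain ⟨d, hd⟩ := Nat.exists_eq_add_of_le hB0.le
    rw [hd, Nat.add_sub_cancel_left] at hchord hlt
    rw [hd]
    refine ⟨by linarith [hchord.1], fun _ hab' => ?_⟩
    have := hchord.2 (by lia) (by lia) hlt
    linarith

/-- Two cross-intersecting families that both have the size of a full star are full stars with a
common centre, provided the sizes of their members add up to less than `n`. -/
lemma CrossIntersecting.exists_eq_fullStar (h : CrossIntersecting A B)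
    (hA : A ⊆ kSubsets n a) (hB : B ⊆ kSubsets n b) (hab : a + b < n) (ha : 1 ≤ a) (hb : 1 ≤ b)
    (hAc : #A = (n - 1).choose (a - 1)) (hBc : #B = (n - 1).choose (b - 1)) :
    ∃ v, B = fullStar b v := by
  have h1 := h.card_add_card_shadow_le hA hB hab.le
  obtain ⟨N, rfl⟩ : ∃ N, n = N + 1 := ⟨n - 1, by lia⟩
  obtain ⟨p, rfl⟩ : ∃ p, a = p + 1 := ⟨a - 1, by lia⟩
  have hP := Nat.choose_succ_succ N p
  rw [Nat.succ_eq_add_one] at hP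
  simp only [Nat.add_sub_cancel] at hAc hBc
  obtain ⟨v, hv⟩ := exists_forall_notMem_of_card_shadow_le (a := p + 1)
    (sized_compls_of_subset_kSubsets hB) ha (by lia) (by lia)
    (by rw [card_compls, hBc]; exact Nat.choose_symm_of_eq_add (by lia))
    (by simp only [Nat.add_sub_cancel]; lia)
  refine ⟨v, eq_of_subset_of_card_le (fun F hF => mem_filter.2 ⟨hB hF, ?_⟩) ?_⟩
  · have := hv Fᶜ (compl_mem_compls hF)
    simpa using this
  · rw [card_fullStar hb, hBc]
    simp

end Families

/-! ### Inequalities between binomial coefficients -/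

section Binomials

lemma choose_le_choose_of_add_le {n a c : ℕ} (hac : a ≤ c) (h : a + c ≤ n) :
    n.choose a ≤ n.choose c := by
  induction n generalizing a c with
  | zero => rw [show a = c by lia]
  | succ n ih =>
    rcases hac.eq_or_lt with rfl | hlt
    · exact le_rfl
    obtain ⟨c, rfl⟩ : ∃ d, c = d + 1 := ⟨c - 1, by lia⟩
    cases a with
    | zero =>
      rw [Nat.choose_zero_right]
      exact Nat.choose_pos (by lia)
    | succ a =>
      rw [Nat.choose_succ_succ, Nat.choose_succ_succ]
      have h1 := ih (a := a) (c := c + 1) (by lia) (by lia)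
      have h2 := ih (a := a + 1) (c := c) (by lia) (by lia)
      simp only [Nat.succ_eq_add_one]
      lia

lemma choose_lt_choose_of_add_lt {n a c : ℕ} (hac : a < c) (h : a + c < n) :
    n.choose a < n.choose c := by
  induction n generalizing a c with
  | zero => lia
  | succ n ih =>
    obtain ⟨c, rfl⟩ : ∃ d, c = d + 1 := ⟨c - 1, by lia⟩
    cases a with
    | zero =>
      rw [Nat.choose_zero_right, Nat.choose_succ_succ]
      have h1 : 0 < n.choose c := Nat.choose_pos (by lia)
      have h2 : 0 < n.choose (c + 1) := Nat.choose_pos (by lia)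
      simp only [Nat.succ_eq_add_one]
      lia
    | succ a =>
      rw [Nat.choose_succ_succ, Nat.choose_succ_succ]
      have h1 := ih (a := a) (c := c + 1) (by lia) (by lia)
      have h2 := choose_le_choose_of_add_le (n := n) (a := a + 1) (c := c) (by lia) (by lia)
      simp only [Nat.succ_eq_add_one]
      lia

/-- The number of `k`-subsets of an `(m + p)`-element set that meet a fixed `m`-element subset
without containing it, given by the Pascal recursion that adds the points outside that subset one
at a time. -/
def splitCount (m : ℕ) : ℕ → ℕ → ℕ
  | 0, k => if 0 < k ∧ k < m then m.choose k else 0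
  | _ + 1, 0 => 0
  | p + 1, k + 1 => splitCount m p k + splitCount m p (k + 1)

lemma splitCount_zero (m p : ℕ) : splitCount m p 0 = 0 := by
  cases p <;> simp [splitCount]

lemma splitCount_add {m : ℕ} (hm : 1 ≤ m) (p k : ℕ) :
    splitCount m p k + p.choose k + (if m ≤ k then p.choose (k - m) else 0) = (m + p).choose k := by
  induction p generalizing k with
  | zero =>
    rcases Nat.eq_zero_or_pos k with rfl | hk
    · simp [splitCount]; lia
    rcases lt_trichotomy k m with h | rfl | h
    · simp [splitCount, hk, h, Nat.choose_eq_zero_of_lt hk]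
    · simp [splitCount, Nat.choose_eq_zero_of_lt hk]
    · have h1 : Nat.choose 0 (k - m) = 0 := Nat.choose_eq_zero_of_lt (by lia)
      simp [splitCount, Nat.choose_eq_zero_of_lt hk, Nat.choose_eq_zero_of_lt h, h1, h.le,
        not_lt.2 h.le]
  | succ p ih =>
    cases k with
    | zero => simp [splitCount]; lia
    | succ k =>
      have h1 := ih k
      have h2 := ih (k + 1)
      rw [← add_assoc, Nat.choose_succ_succ (m + p) k, ← h1, Nat.succ_eq_add_one, ← h2,
        Nat.choose_succ_succ p k, splitCount, Nat.succ_eq_add_one]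
      by_cases hmk : m ≤ k
      · rw [if_pos (show m ≤ k + 1 by lia), if_pos hmk, if_pos (show m ≤ k + 1 by lia),
          show k + 1 - m = (k - m) + 1 by lia, Nat.choose_succ_succ p (k - m)]
        ring
      · by_cases hmk' : m ≤ k + 1
        · rw [if_pos hmk', if_neg hmk, if_pos hmk', show k + 1 - m = 0 by lia]
          simp only [Nat.choose_zero_right]
          ring
        · rw [if_neg hmk', if_neg hmk, if_neg hmk']
          ring

lemma splitCount_mono {m p a c : ℕ} (hac : a ≤ c) (h : a + c ≤ m + p) :
    splitCount m p a ≤ splitCount m p c := by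
  induction p generalizing a c with
  | zero =>
    rcases hac.eq_or_lt with rfl | hlt
    · exact le_rfl
    rcases Nat.eq_zero_or_pos a with rfl | ha
    · simp [splitCount]
    · rw [splitCount, splitCount, if_pos (by lia), if_pos (by lia)]
      exact choose_le_choose_of_add_le hac h
  | succ p ih =>
    rcases hac.eq_or_lt with rfl | hlt
    · exact le_rfl
    obtain ⟨c, rfl⟩ : ∃ d, c = d + 1 := ⟨c - 1, by lia⟩
    cases a with
    | zero => simp [splitCount]
    | succ a =>
      rw [splitCount, splitCount]
      have h1 := ih (a := a) (c := c + 1) (by lia) (by lia)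
      have h2 := ih (a := a + 1) (c := c) (by lia) (by lia)
      lia

lemma splitCount_pos {m p c : ℕ} (hm : 2 ≤ m) (hc : 1 ≤ c) (h : c < m + p) :
    0 < splitCount m p c := by
  induction p generalizing c with
  | zero =>
    rw [splitCount, if_pos (by lia)]
    exact Nat.choose_pos (by lia)
  | succ p ih =>
    obtain ⟨c, rfl⟩ : ∃ d, c = d + 1 := ⟨c - 1, by lia⟩
    rw [splitCount]
    rcases Nat.eq_zero_or_pos c with rfl | hc'
    · have := ih (c := 1) le_rfl (by lia)
      simp only [zero_add]
      lia
    · have := ih (c := c) hc' (by lia)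
      lia

lemma splitCount_strictMono {m p a c : ℕ} (hm : 2 ≤ m) (hac : a < c) (h : a + c < m + p) :
    splitCount m p a < splitCount m p c := by
  rcases Nat.eq_zero_or_pos a with rfl | ha
  · rw [splitCount_zero]
    exact splitCount_pos hm (by lia) (by lia)
  induction p generalizing a c with
  | zero =>
    rw [splitCount, splitCount, if_pos (by lia), if_pos (by lia)]
    exact choose_lt_choose_of_add_lt hac h
  | succ p ih =>
    obtain ⟨c, rfl⟩ : ∃ d, c = d + 1 := ⟨c - 1, by lia⟩
    obtain ⟨a, rfl⟩ : ∃ d, a = d + 1 := ⟨a - 1, by lia⟩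
    rw [splitCount, splitCount]
    have h2 := splitCount_mono (m := m) (p := p) (a := a + 1) (c := c) (by lia) (by lia)
    rcases Nat.eq_zero_or_pos a with rfl | ha'
    · have := splitCount_pos (m := m) (p := p) (c := c + 1) hm (by lia) (by lia)
      rw [splitCount_zero]
      lia
    · have h1 := ih (a := a) (c := c + 1) (by lia) (by lia) ha'
      lia

/-- The number of `k`-sets that meet an `m`-set without containing it does not decrease from
`k = a` to `k = c` when `a ≤ c` and `a + c ≤ n`. -/
lemma choose_meeting_mono {n m a c : ℕ} (hm : 2 ≤ m) (hma : m ≤ a) (hac : a ≤ c) (h : a + c ≤ n) :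
    n.choose a + (n - m).choose c + (n - m).choose (c - m)
      ≤ n.choose c + (n - m).choose a + (n - m).choose (a - m) ∧
    (a < c → a + c < n → n.choose a + (n - m).choose c + (n - m).choose (c - m)
      < n.choose c + (n - m).choose a + (n - m).choose (a - m)) := by
  obtain ⟨p, rfl⟩ : ∃ p, n = m + p := ⟨n - m, by lia⟩
  have h1 := splitCount_add (m := m) (by lia) p a
  have h2 := splitCount_add (m := m) (by lia) p c
  rw [if_pos hma] at h1
  rw [if_pos (hma.trans hac)] at h2
  rw [Nat.add_sub_cancel_left]
  refine ⟨?_, fun hlt h' => ?_⟩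
  · have := splitCount_mono hac h
    lia
  · have := splitCount_strictMono hm hlt h'
    lia

/-- `a`-sets meeting a `b`-set are fewer than `b`-sets meeting an `a`-set: the proportions of the
two families in their levels agree, and the level `b` is larger. -/
lemma choose_meeting_lt_swap {n a b : ℕ} (ha : 1 ≤ a) (hab : a < b) (h : a + b < n) :
    n.choose a + (n - a).choose b < n.choose b + (n - b).choose a := by
  have h1 := Nat.choose_mul (n := n) (k := a + b) (s := a) (by lia)
  have h2 := Nat.choose_mul (n := n) (k := a + b) (s := b) (by lia)
  rw [Nat.add_sub_cancel_left] at h1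
  rw [Nat.add_sub_cancel, ← Nat.choose_symm_add, h1] at h2
  have hxy := choose_lt_choose_of_add_lt hab h
  have hu : (n - b).choose a < n.choose a := by
    obtain ⟨n, rfl⟩ : ∃ N, n = N + 1 := ⟨n - 1, by lia⟩
    obtain ⟨a, rfl⟩ : ∃ d, a = d + 1 := ⟨a - 1, by lia⟩
    have h3 := Nat.choose_le_choose (a + 1) (show n + 1 - b ≤ n by lia)
    have h4 : 0 < n.choose a := Nat.choose_pos (by lia)
    rw [Nat.choose_succ_succ n a]
    simp only [Nat.succ_eq_add_one]
    lia
  have hx : 0 < n.choose a := Nat.choose_pos (by lia)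
  zify at *
  nlinarith [mul_pos (sub_pos.2 hxy) (sub_pos.2 hu)]

/-- For two families, the `b`-sets meeting a fixed `a`-set together with that `a`-set are at least
as many as the members of two full stars. -/
lemma choose_star_pair_le {n a b : ℕ} (ha : 1 ≤ a) (hab : a ≤ b) (h : a + b ≤ n) :
    (n - 1).choose (a - 1) + (n - 1).choose (b - 1) + (n - a).choose b ≤ n.choose b + 1 := by
  have key : ∀ m, 1 ≤ m → m ≤ a →
      (n - 1).choose (a - 1) + (n - 1).choose (b - 1) + (n - m).choose b
        ≤ n.choose b + (n - m).choose (a - m) := by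
    intro m hm
    induction m, hm using Nat.le_induction with
    | base =>
      intro _
      have := Nat.choose_eq_choose_pred_add (n := n) (k := b) (by lia) (by lia)
      lia
    | succ m hm ih =>
      intro hma
      have h0 := ih (by lia)
      have h1 := Nat.choose_eq_choose_pred_add (n := n - m) (k := b) (by lia) (by lia)
      have h2 := Nat.choose_eq_choose_pred_add (n := n - m) (k := a - m) (by lia) (by lia)
      have h3 := choose_le_choose_of_add_le (n := n - m - 1) (a := a - m) (c := b - 1)
        (by lia) (by lia)
      rw [show n - (m + 1) = n - m - 1 by lia, show a - (m + 1) = a - m - 1 by lia]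
      lia
  simpa using key a ha le_rfl

end Binomials

/-! ### One family larger than a full star -/

section Unimodal

variable {F w c : ℕ → ℕ} {M : ℕ}

lemma lt_of_increments_neg {m : ℕ} (hm : 1 < m)
    (hstep : ∀ l, 1 ≤ l → l < m → F (l + 1) + c l = F l + w l)
    (hneg : ∀ l, 1 ≤ l → l < m → w l < c l) : F m < F 1 := by
  have key : ∀ l, 2 ≤ l → l ≤ m → F l < F 1 := by
    intro l hl
    induction l, hl using Nat.le_induction with
    | base =>
      intro h
      have h1 := hstep 1 le_rfl (by lia)
      have h2 := hneg 1 le_rfl (by lia)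
      simp only [Nat.reduceAdd] at h1
      lia
    | succ l hl ih =>
      intro h
      have h0 := ih (by lia)
      have h1 := hstep l (by lia) (by lia)
      have h2 := hneg l (by lia) (by lia)
      lia
  exact key m hm le_rfl

/-- A sequence whose increments, after a positive rescaling, strictly increase lies strictly
below the larger of its end values at every interior point. -/
lemma lt_max_of_increments {m : ℕ} (hm : 1 < m) (hmM : m < M)
    (hstep : ∀ l, 1 ≤ l → l < M → F (l + 1) + c l = F l + w l)
    (hw : ∀ l, 1 ≤ l → l < M → 0 < w l)
    (hratio : ∀ l, 1 ≤ l → l + 1 < M → c (l + 1) * w l < c l * w (l + 1)) :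
    F m < max (F 1) (F M) := by
  rcases lt_or_ge (w (m - 1)) (c (m - 1)) with h | h
  · -- The increments are negative up to `m`.
    refine (lt_of_increments_neg hm (fun l hl hlm => hstep l hl (by lia)) ?_).trans_le
      (le_max_left _ _)
    have key : ∀ d l, 1 ≤ l → l + d = m - 1 → w l < c l := by
      intro d
      induction d with
      | zero => intro l _ hld; rwa [show l = m - 1 by lia]
      | succ d ih =>
        intro l hl hld
        have h1 := ih (l + 1) (by lia) (by lia)
        have h2 := hratio l hl (by lia)
        have h3 := hw l hl (by lia)
        by_contra! h4
        have h5 : c l * w (l + 1) ≤ w l * c (l + 1) := Nat.mul_le_mul h4 h1.le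
        linarith
    intro l hl hlm
    exact key (m - 1 - l) l hl (by lia)
  · -- The increments are positive from `m` on.
    have hpos : ∀ l, m ≤ l → l < M → c l < w l := by
      intro l hl
      induction l, hl using Nat.le_induction with
      | base =>
        intro _
        have h2 := hratio (m - 1) (by lia) (by lia)
        rw [Nat.sub_add_cancel (by lia)] at h2
        by_contra! h4
        have h5 : c (m - 1) * w m ≤ w (m - 1) * c m := Nat.mul_le_mul h h4
        linarith
      | succ l hl ih =>
        intro hlM
        have h1 := ih (by lia)
        have h2 := hratio l (by lia) hlM
        by_contra! h4
        have h5 : c l * w (l + 1) ≤ w l * c (l + 1) := Nat.mul_le_mul h1.le h4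
        linarith
    have key : ∀ l, m + 1 ≤ l → l ≤ M → F m < F l := by
      intro l hl
      induction l, hl using Nat.le_induction with
      | base =>
        intro h
        have h1 := hstep m (by lia) (by lia)
        have h2 := hpos m le_rfl (by lia)
        lia
      | succ l hl ih =>
        intro h
        have h0 := ih (by lia)
        have h1 := hstep l (by lia) (by lia)
        have h2 := hpos l (by lia) (by lia)
        lia
    exact (key M hmM le_rfl).trans_le (le_max_right _ _)

end Unimodal

section Interpolation

variable {ι : Type*} {n a : ℕ} {J : Finset ι} {k : ι → ℕ} {M : ℕ}

/-- The total size of the families in which, for a fixed `m`-set `T`, one family consists of the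
`a`-sets meeting `T` and the family with index `j ∈ J` consists of the `k j`-sets containing `T`. -/
def meetContainBound (n a : ℕ) (J : Finset ι) (k : ι → ℕ) (m : ℕ) : ℕ :=
  n.choose a - (n - m).choose a + ∑ j ∈ J, (n - m).choose (k j - m)

lemma meetContainBound_succ {m : ℕ} (ha : 1 ≤ a) (hm : m < n) (hk : ∀ j ∈ J, m < k j) :
    meetContainBound n a J k (m + 1) + ∑ j ∈ J, (n - m - 1).choose (k j - m)
      = meetContainBound n a J k m + (n - m - 1).choose (a - 1) := by
  have h1 := Nat.choose_eq_choose_pred_add (n := n - m) (k := a) (by lia) (by lia)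
  have h2 : ∑ j ∈ J, (n - m).choose (k j - m)
      = ∑ j ∈ J, (n - (m + 1)).choose (k j - (m + 1)) + ∑ j ∈ J, (n - m - 1).choose (k j - m) := by
    rw [← sum_add_distrib]
    refine sum_congr rfl fun j hj => ?_
    have := hk j hj
    rw [Nat.choose_eq_choose_pred_add (n := n - m) (k := k j - m) (by lia) (by lia)]
    rw [show n - (m + 1) = n - m - 1 by lia, show k j - (m + 1) = k j - m - 1 by lia]
  have h3 := Nat.choose_le_choose a (show n - m ≤ n by lia)
  rw [meetContainBound, meetContainBound, h2, show n - (m + 1) = n - m - 1 by lia]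
  lia

lemma meetContainBound_one (ha : 1 ≤ a) (hn : 1 ≤ n) :
    meetContainBound n a J k 1
      = (n - 1).choose (a - 1) + ∑ j ∈ J, (n - 1).choose (k j - 1) := by
  have h1 := Nat.choose_eq_choose_pred_add (n := n) (k := a) (by lia) (by lia)
  rw [meetContainBound, h1]
  simp

lemma choose_ratio_le {N p q : ℕ} (hN : 1 ≤ N) (hq : 1 ≤ q) (hpq : p + q ≤ N) :
    (N - 1).choose (q - 1) * N.choose p ≤ N.choose q * (N - 1).choose p ∧
    (p + q < N → (N - 1).choose (q - 1) * N.choose p < N.choose q * (N - 1).choose p) := by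
  obtain ⟨N, rfl⟩ : ∃ d, N = d + 1 := ⟨N - 1, by lia⟩
  obtain ⟨q, rfl⟩ : ∃ d, q = d + 1 := ⟨q - 1, by lia⟩
  simp only [Nat.add_sub_cancel]
  have h1 := Nat.add_one_mul_choose_eq N q
  have h2 := Nat.choose_mul_succ_eq N p
  have h3 : 0 < (N + 1).choose (q + 1) * (N + 1).choose p :=
    Nat.mul_pos (Nat.choose_pos (by lia)) (Nat.choose_pos (by lia))
  have e1 : (N + 1) * (N.choose q * (N + 1).choose p)
      = (N + 1).choose (q + 1) * (N + 1).choose p * (q + 1) := by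
    rw [← mul_assoc, h1]; ring
  have e2 : (N + 1) * ((N + 1).choose (q + 1) * N.choose p)
      = (N + 1).choose (q + 1) * (N + 1).choose p * (N + 1 - p) := by
    rw [mul_assoc ((N + 1).choose (q + 1)), ← h2]; ring
  constructor
  · refine Nat.le_of_mul_le_mul_left ?_ (show 0 < N + 1 by lia)
    rw [e1, e2]
    exact Nat.mul_le_mul_left _ (by lia)
  · intro h
    refine Nat.lt_of_mul_lt_mul_left (a := N + 1) ?_
    rw [e1, e2]
    exact Nat.mul_lt_mul_of_pos_left (by lia) h3

lemma meetContainBound_ratio {m : ℕ} (ha : 1 ≤ a) (hk : ∀ j ∈ J, m + 1 < k j)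
    (hak : ∀ j ∈ J, a + k j ≤ n) (hs : ∃ j ∈ J, a + k j < n) :
    (∑ j ∈ J, (n - (m + 1) - 1).choose (k j - (m + 1))) * (n - m - 1).choose (a - 1)
      < (∑ j ∈ J, (n - m - 1).choose (k j - m)) * (n - (m + 1) - 1).choose (a - 1) := by
  rw [sum_mul, sum_mul]
  have key : ∀ j ∈ J, _ := fun j hj =>
    have := hk j hj
    have := hak j hj
    choose_ratio_le (N := n - m - 1) (p := a - 1) (q := k j - m) (by lia) (by lia) (by lia)
  have e : n - (m + 1) - 1 = n - m - 1 - 1 := by lia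
  refine sum_lt_sum (fun j hj => ?_) ?_
  · have := (key j hj).1
    rwa [e, show k j - (m + 1) = k j - m - 1 by lia]
  · obtain ⟨j, hj, hlt⟩ := hs
    have := hk j hj
    refine ⟨j, hj, ?_⟩
    have := (key j hj).2 (by lia)
    rwa [e, show k j - (m + 1) = k j - m - 1 by lia]

/-- If the sets of two of the uniformities fill up the ground set and there is a third family, the
full stars are strictly better than the families given by an `M`-set with `M ≥ 2`. -/
lemma meetContainBound_lt_one (hM : 2 ≤ M) (ha : 1 ≤ a) (hk : ∀ j ∈ J, M ≤ k j)
    (hak : ∀ j ∈ J, a + k j ≤ n) {i j : ι} (hi : i ∈ J) (hj : j ∈ J) (hij : i ≠ j)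
    (h : a + k i = n) : meetContainBound n a J k M < meetContainBound n a J k 1 := by
  have hi' := hk i hi
  refine lt_of_increments_neg (c := fun l => ∑ j ∈ J, (n - l - 1).choose (k j - l))
    (w := fun l => (n - l - 1).choose (a - 1)) hM ?_ ?_
  · intro l _ hl
    exact meetContainBound_succ ha (by lia) fun j hj => hl.trans_le (hk j hj)
  · intro l _ hl
    classical
    have h1 : ∑ j ∈ ({i, j} : Finset ι), (n - l - 1).choose (k j - l)
        ≤ ∑ j ∈ J, (n - l - 1).choose (k j - l) :=
      sum_le_sum_of_subset (insert_subset hi (singleton_subset_iff.2 hj))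
    rw [sum_pair hij] at h1
    have h2 : (n - l - 1).choose (k i - l) = (n - l - 1).choose (a - 1) :=
      Nat.choose_symm_of_eq_add (by lia)
    have h3 := hk j hj
    have h4 := hak j hj
    have h5 : 0 < (n - l - 1).choose (k j - l) := Nat.choose_pos (by lia)
    lia

/-- A family `A` of `a`-sets that is larger than a full star, together with families that
cross-intersect it: between two consecutive numbers of `a`-sets meeting an `m`-set the total size
is bounded by linear interpolation, so it is largest at `m = 1` or at the largest possible `m`. -/
lemma card_add_sum_card_le {A : Finset (Finset (Fin n))} {B : ι → Finset (Finset (Fin n))}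
    (hA : A ⊆ kSubsets n a) (hB : ∀ j ∈ J, B j ⊆ kSubsets n (k j))
    (hAB : ∀ j ∈ J, CrossIntersecting A (B j)) (ha : 1 ≤ a) (hM : 1 ≤ M)
    (hk : ∀ j ∈ J, M ≤ k j) (hak : ∀ j ∈ J, a + k j ≤ n)
    (hlow : (n - 1).choose (a - 1) < #A) (hup : #A + (n - M).choose a ≤ n.choose a)
    (hs : (∃ j ∈ J, a + k j < n) ∨ 2 ≤ #J) :
    #A + ∑ j ∈ J, #(B j)
      ≤ max (meetContainBound n a J k 1) (meetContainBound n a J k M) ∧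
    (#A + ∑ j ∈ J, #(B j) = max (meetContainBound n a J k 1) (meetContainBound n a J k M) →
      #A + (n - M).choose a = n.choose a ∧
        meetContainBound n a J k 1 ≤ meetContainBound n a J k M) := by
  obtain ⟨j₀, hj₀⟩ : J.Nonempty := by
    rcases hs with ⟨j, hj, -⟩ | h
    · exact ⟨j, hj⟩
    · exact card_pos.1 (by lia)
  have hk₀ := hk j₀ hj₀
  have hak₀ := hak j₀ hj₀
  have hn1 := Nat.choose_eq_choose_pred_add (n := n) (k := a) (by lia) (by lia)
  have hex : ∃ l, #A + (n - l).choose a ≤ n.choose a := ⟨M, hup⟩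
  obtain ⟨m, hm1, hmM, hlt, hle⟩ : ∃ m, 1 ≤ m ∧ m < M ∧ n.choose a < #A + (n - m).choose a ∧
      #A + (n - m - 1).choose a ≤ n.choose a := by
    classical
    have h1 := Nat.find_spec hex
    have h2 : Nat.find hex ≤ M := Nat.find_min' hex hup
    have h3 : 2 ≤ Nat.find hex := by
      by_contra! h3
      have := Nat.choose_le_choose a (show n - 1 ≤ n - Nat.find hex by lia)
      lia
    refine ⟨Nat.find hex - 1, by lia, by lia, ?_, ?_⟩
    · exact not_le.1 (Nat.find_min hex (show Nat.find hex - 1 < Nat.find hex by lia))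
    · rwa [show n - (Nat.find hex - 1) - 1 = n - Nat.find hex by lia]
  set F := meetContainBound n a J k with hF
  set w : ℕ → ℕ := fun l => (n - l - 1).choose (a - 1) with hw
  set c : ℕ → ℕ := fun l => ∑ j ∈ J, (n - l - 1).choose (k j - l) with hc
  have hstep : ∀ l, 1 ≤ l → l < M → F (l + 1) + c l = F l + w l := fun l _ hl =>
    meetContainBound_succ ha (by lia) fun j hj => hl.trans_le (hk j hj)
  have hwpos : ∀ l, 1 ≤ l → l < M → 0 < w l := fun l _ hl => Nat.choose_pos (by lia)
  obtain ⟨z, hz⟩ := Nat.exists_eq_add_of_lt hlt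
  replace hz : n.choose a + (z + 1) = #A + (n - m).choose a := by lia
  have hnm := Nat.choose_eq_choose_pred_add (n := n - m) (k := a) (by lia) (by lia)
  have hzw : z + 1 ≤ w m := by simp only [hw]; lia
  have hpair : ∀ j ∈ J, _ := fun j hj => (hAB j hj).card_interpolation hA (hB j hj) (hak j hj) ha
    (hmM.trans_le (hk j hj)) (Nat.succ_pos z) hzw hz
  have hFm : #A + ∑ j ∈ J, (n - m).choose (k j - m) = F m + (z + 1) := by
    have := Nat.choose_le_choose a (show n - m ≤ n by lia)
    rw [hF, meetContainBound]
    lia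
  have hsum : w m * (#A + ∑ j ∈ J, #(B j)) + (z + 1) * c m ≤ w m * (F m + (z + 1)) := by
    have := sum_le_sum fun j hj => (hpair j hj).1
    rw [sum_add_distrib, ← mul_sum, ← mul_sum, ← mul_sum] at this
    rw [← hFm, mul_add, mul_add, add_assoc]
    exact Nat.add_le_add_left this _
  have hstepm := hstep m hm1 hmM
  have hwm := hwpos m hm1 hmM
  rcases em (∃ j ∈ J, a + k j < n) with hs' | hs'
  · have hint : ∀ l, 1 < l → l < M → F l < max (F 1) (F M) := fun l hl hlM =>
      lt_max_of_increments hl hlM hstep hwpos fun l _ hl =>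
        meetContainBound_ratio ha (fun j hj => hl.trans_le (hk j hj)) hak hs'
    have h1 : F m ≤ max (F 1) (F M) := by
      rcases hm1.eq_or_lt with h | h
      · rw [← h]; exact le_max_left _ _
      · exact (hint m h hmM).le
    have h2 : F (m + 1) ≤ max (F 1) (F M) := by
      rcases (Nat.succ_le_iff.2 hmM).eq_or_lt with h | h
      · rw [← Nat.succ_eq_add_one, h]; exact le_max_right _ _
      · exact (hint (m + 1) (by lia) h).le
    -- The total size is a convex combination of the values at `m` and `m + 1`.
    have hconv : ∀ X, w m * X + (z + 1) * c m ≤ w m * (F m + (z + 1)) →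
        w m * X ≤ w m * max (F 1) (F M) := by
      intro X hX
      obtain ⟨d, hd⟩ := Nat.exists_eq_add_of_le hzw
      have h3 : (z + 1) * (F (m + 1) + c m) = (z + 1) * (F m + w m) := by rw [hstepm]
      have h4 := Nat.mul_le_mul_left d h1
      have h5 := Nat.mul_le_mul_left (z + 1) h2
      rw [hd] at hX h3 ⊢
      linarith
    refine ⟨Nat.le_of_mul_le_mul_left (hconv _ hsum) hwm, fun heq => ?_⟩
    have hzw' : z + 1 = w m := by
      by_contra hne
      have hlt' : w m * (#A + ∑ j ∈ J, #(B j)) + (z + 1) * c m < w m * (F m + (z + 1)) := by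
        obtain ⟨j, hj, hjn⟩ := hs'
        have := sum_lt_sum (fun j hj => (hpair j hj).1)
          ⟨j, hj, (hpair j hj).2 (lt_of_le_of_ne hzw hne) hjn⟩
        rw [sum_add_distrib, ← mul_sum, ← mul_sum, ← mul_sum] at this
        rw [← hFm, mul_add, mul_add, add_assoc]
        exact Nat.add_lt_add_left this _
      obtain ⟨d, hd⟩ := Nat.exists_eq_add_of_le hzw
      have h3 : (z + 1) * (F (m + 1) + c m) = (z + 1) * (F m + w m) := by rw [hstepm]
      have h4 := Nat.mul_le_mul_left d h1
      have h5 := Nat.mul_le_mul_left (z + 1) h2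
      rw [heq, hd] at hlt'
      rw [hd] at h3
      linarith
    have h3 : max (F 1) (F M) ≤ F (m + 1) := by
      have h4 : w m * (F (m + 1) + c m) = w m * (F m + w m) := by rw [hstepm]
      rw [hzw', heq] at hsum
      have h5 : w m * max (F 1) (F M) ≤ w m * F (m + 1) := by linarith
      exact Nat.le_of_mul_le_mul_left h5 hwm
    have h4 : m + 1 = M := by
      by_contra hne
      exact absurd (hint (m + 1) (by lia) (by lia)) (not_lt.2 h3)
    rw [h4] at h3
    refine ⟨?_, (le_max_left _ _).trans h3⟩
    have e : n - M = n - m - 1 := by lia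
    have : w m = (n - m - 1).choose (a - 1) := rfl
    rw [e]
    lia
  · have hJ : 2 ≤ #J := hs.resolve_left hs'
    have hall : ∀ j ∈ J, a + k j = n := fun j hj => by
      by_contra hne
      exact hs' ⟨j, hj, lt_of_le_of_ne (hak j hj) hne⟩
    have hneg : ∀ l, 1 ≤ l → l < M → w l < c l := by
      intro l hl hlM
      have h1 : c l = #J * w l := by
        rw [← smul_eq_mul, ← sum_const]
        refine sum_congr rfl fun j hj => ?_
        have h2 := hall j hj
        have h3 := hk j hj
        exact Nat.choose_symm_of_eq_add (by lia)
      have h2 := hwpos l hl hlM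
      rw [h1]
      nlinarith
    have h1 : F m ≤ F 1 := by
      rcases hm1.eq_or_lt with h | h
      · rw [← h]
      · exact (lt_of_increments_neg h (fun l hl hlm => hstep l hl (by lia))
          (fun l hl hlm => hneg l hl (by lia))).le
    have h2 : #A + ∑ j ∈ J, #(B j) < F m := by
      refine Nat.lt_of_mul_lt_mul_left (a := w m) ?_
      have h3 := Nat.mul_lt_mul_of_pos_left (hneg m hm1 hmM) (Nat.succ_pos z)
      rw [Nat.succ_eq_add_one] at h3
      linarith
    have h3 : #A + ∑ j ∈ J, #(B j) < max (F 1) (F M) :=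
      (h2.trans_le h1).trans_le (le_max_left _ _)
    exact ⟨h3.le, fun heq => absurd heq h3.ne⟩

end Interpolation

/-- Bound for two families where the one of the smaller uniformity exceeds a full star. -/
lemma CrossIntersecting.card_add_card_le {n a b : ℕ} {A B : Finset (Finset (Fin n))}
    (h : CrossIntersecting A B) (hA : A ⊆ kSubsets n a) (hB : B ⊆ kSubsets n b)
    (hBne : B.Nonempty) (ha : 1 ≤ a) (hab : a < b) (hn : a + b ≤ n)
    (hlow : (n - 1).choose (a - 1) < #A) :
    #A + #B + (n - a).choose b ≤ n.choose b + 1 ∧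
    (a + b < n → #A + #B + (n - a).choose b < n.choose b + 1) := by
  rcases hn.eq_or_lt with hn | hn
  · refine ⟨?_, fun h => absurd hn h.ne⟩
    have h1 := h.card_add_card_shadow_le hA hB hn.le
    rw [show n - b - a = 0 by lia, Function.iterate_zero_apply, card_compls] at h1
    rw [show n - a = b by lia, Nat.choose_self, Nat.choose_symm_of_eq_add (a := b) (b := a) (by lia)]
    lia
  have hup : #A + (n - b).choose a ≤ n.choose a := by
    refine h.card_add_choose_le hA hB hn.le le_rfl ?_
    simpa using hBne.card_pos
  have hmain := card_add_sum_card_le (J := {()}) (k := fun _ => b) (B := fun _ => B) (M := b) hA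
    (by simpa using hB) (by simpa using h) ha (by lia) (by simp) (by simpa using hn.le) hlow hup
    (Or.inl (by simpa using hn))
  rw [meetContainBound_one ha (by lia)] at hmain
  simp only [meetContainBound, sum_singleton, Nat.sub_self, Nat.choose_zero_right] at hmain
  have h1 := choose_star_pair_le ha hab.le hn.le
  have h2 := choose_meeting_lt_swap ha hab hn
  have h3 : (n - b).choose a ≤ n.choose a := Nat.choose_le_choose a (by lia)
  suffices #A + #B + (n - a).choose b < n.choose b + 1 from ⟨this.le, fun _ => this⟩
  rcases hmain.1.eq_or_lt with heq | hlt
  · have := (hmain.2 heq).2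
    rw [max_eq_right this] at heq
    lia
  · rcases le_total ((n - 1).choose (a - 1) + (n - 1).choose (b - 1))
      (n.choose a - (n - b).choose a + 1) with h4 | h4
    · rw [max_eq_right h4] at hlt
      lia
    · rw [max_eq_left h4] at hlt
      lia

/-! ### Complementary families -/

section Complementary

variable {n a b : ℕ} {A B : Finset (Finset (Fin n))}

lemma card_kSubsets_sdiff_compls (hA : A ⊆ kSubsets n a) (hn : n = a + b) :
    #(kSubsets n b \ Aᶜˢ) + #A = n.choose b := by
  have h : Aᶜˢ ⊆ kSubsets n b := by
    intro F hF
    have h1 := mem_kSubsets.1 (hA (mem_compls.1 hF))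
    rw [card_compl, Fintype.card_fin] at h1
    have h2 := card_le_univ F
    rw [Fintype.card_fin] at h2
    exact mem_kSubsets.2 (by lia)
  rw [← card_compls (s := A), card_sdiff_add_card_eq_card h, card_kSubsets]

lemma CrossIntersecting.subset_sdiff_compls (h : CrossIntersecting A B) (hB : B ⊆ kSubsets n b) :
    B ⊆ kSubsets n b \ Aᶜˢ := by
  intro F hF
  refine mem_sdiff.2 ⟨hB hF, fun hFA => ?_⟩
  obtain ⟨x, hx⟩ := h _ (mem_compls.1 hFA) F hF
  rw [mem_inter, mem_compl] at hx
  exact hx.1 hx.2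

lemma CrossIntersecting.eq_sdiff_compls (h : CrossIntersecting A B) (hA : A ⊆ kSubsets n a)
    (hB : B ⊆ kSubsets n b) (hn : n = a + b) (hc : n.choose b ≤ #A + #B) :
    B = kSubsets n b \ Aᶜˢ := by
  refine eq_of_subset_of_card_le (h.subset_sdiff_compls hB) ?_
  have := card_kSubsets_sdiff_compls hA hn
  lia

end Complementary

/-! ### Several families -/

/-- Families that all have the sizes of full stars are full stars with a common centre, provided
two of them have uniformities adding up to less than `n`. -/
lemma exists_forall_eq_fullStar {ι : Type*} {n : ℕ} {k : ι → ℕ}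
    {𝒜 : ι → Finset (Finset (Fin n))} (hpos : ∀ i, 1 ≤ k i) (hn : ∀ i j, i ≠ j → k i + k j ≤ n)
    (hunif : ∀ i, 𝒜 i ⊆ kSubsets n (k i))
    (hcross : ∀ i j, i ≠ j → CrossIntersecting (𝒜 i) (𝒜 j))
    (hcard : ∀ i, #(𝒜 i) = (n - 1).choose (k i - 1)) {i j : ι} (hij : i ≠ j)
    (hlt : k i + k j < n) : ∃ v, ∀ l, 𝒜 l = fullStar (k l) v := by
  obtain ⟨v, hv⟩ := (hcross i j hij).exists_eq_fullStar (hunif i) (hunif j) hlt (hpos i) (hpos j)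
    (hcard i) (hcard j)
  refine ⟨v, fun l => ?_⟩
  rcases eq_or_ne l j with rfl | hl
  · exact hv
  · have h := hcross j l hl.symm
    rw [hv, fullStar_eq_meetingFamily] at h
    refine eq_of_subset_of_card_le ?_ ?_
    · rw [fullStar_eq_containingFamily]
      exact h.subset_containingFamily (hunif l) (hpos j) (hn j l hl.symm)
    · rw [card_fullStar (hpos l), hcard l]

section LargeFamily

variable {ι : Type*} [Fintype ι] [DecidableEq ι] {n : ℕ} {k : ι → ℕ} {first last : ι}
  {𝒜 : ι → Finset (Finset (Fin n))}

lemma meetContainBound_erase_one (hn : 1 ≤ n) (i : ι) (hi : 1 ≤ k i) :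
    meetContainBound n (k i) (univ.erase i) k 1 = ∑ j, (n - 1).choose (k j - 1) := by
  rw [meetContainBound_one hi hn]
  exact add_sum_erase univ (fun j => (n - 1).choose (k j - 1)) (mem_univ i)

lemma meetContainBound_erase_add (i : ι) (m : ℕ) :
    meetContainBound n (k i) (univ.erase i) k m + (n - m).choose (k i) + (n - m).choose (k i - m)
      = n.choose (k i) + ∑ j, (n - m).choose (k j - m) := by
  rw [meetContainBound,
    ← add_sum_erase univ (fun j => (n - m).choose (k j - m)) (mem_univ i)]
  have := Nat.choose_le_choose (k i) (show n - m ≤ n by lia)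
  lia

/-- If the family with index `i` consists of as many sets as meet a `k last`-set, the others are
contained in families of all sets containing a common `k last`-set `T`; if all sizes are as large
as possible, the families are the ones determined by `T`. -/
lemma eq_meeting_containing (hlast : ∀ i, k last ≤ k i)
    (hfl : first ≠ last) (hpos : ∀ i, 1 ≤ k i) (hn : ∀ i j, i ≠ j → k i + k j ≤ n)
    (hunif : ∀ i, 𝒜 i ⊆ kSubsets n (k i)) (hne : ∀ i, (𝒜 i).Nonempty)
    (hcross : ∀ i j, i ≠ j → CrossIntersecting (𝒜 i) (𝒜 j)) {i : ι} (hi : k i = k first)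
    (hfull : #(𝒜 i) + (n - k last).choose (k i) = n.choose (k i))
    (hsum : ∑ j, #(𝒜 j) = meetContainBound n (k i) (univ.erase i) k (k last)) :
    ∃ T : Finset (Fin n), #T = k last ∧ 𝒜 i = meetingFamily (k i) T ∧
      ∀ j, j ≠ i → 𝒜 j = containingFamily (k j) T := by
  obtain ⟨j₀, hj₀, hkj₀⟩ : ∃ j, j ≠ i ∧ k j = k last := by
    rcases eq_or_ne i last with rfl | h
    · exact ⟨first, hfl, hi.symm⟩
    · exact ⟨last, h.symm, rfl⟩
  obtain ⟨T, hT⟩ := hne j₀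
  have hTc : #T = k last := by rw [← hkj₀]; exact mem_kSubsets.1 (hunif j₀ hT)
  have hmeet : 𝒜 i = meetingFamily (k i) T := by
    refine eq_of_subset_of_card_le
      ((hcross i j₀ hj₀.symm).subset_meetingFamily (hunif i) hT) ?_
    have := card_meetingFamily_add (k := k i) (T := T)
    rw [hTc] at this
    lia
  have hsub : ∀ j, j ≠ i → 𝒜 j ⊆ containingFamily (k j) T := fun j hj => by
    have h := hcross i j hj.symm
    rw [hmeet] at h
    exact h.subset_containingFamily (hunif j) (hpos i) (hn i j hj.symm)
  refine ⟨T, hTc, hmeet, ?_⟩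
  have hcc : ∀ j, #(containingFamily (k j) T) = (n - k last).choose (k j - k last) := fun j => by
    rw [card_containingFamily (by rw [hTc]; exact hlast j), hTc]
  have hle : ∀ j ∈ univ.erase i, #(𝒜 j) ≤ (n - k last).choose (k j - k last) := fun j hj => by
    rw [← hcc j]
    exact card_le_card (hsub j (ne_of_mem_erase hj))
  rw [meetContainBound, ← add_sum_erase univ (fun j => #(𝒜 j)) (mem_univ i)] at hsum
  have hsum' : ∑ j ∈ univ.erase i, #(𝒜 j)
      = ∑ j ∈ univ.erase i, (n - k last).choose (k j - k last) := by lia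
  have heq := (sum_eq_sum_iff_of_le hle).1 hsum'
  intro j hj
  refine eq_of_subset_of_card_le (hsub j hj) ?_
  rw [hcc j, heq j (mem_erase.2 ⟨hj, mem_univ j⟩)]

/-- The bound for the total size when the family with index `i` is larger than a full star but not
larger than the family of `k i`-sets meeting a `k last`-set. -/
lemma sum_card_le_of_large (hfirst : ∀ i, k i ≤ k first) (hlast : ∀ i, k last ≤ k i)
    (hfl : first ≠ last) (hpos : ∀ i, 1 ≤ k i) (hn : ∀ i j, i ≠ j → k i + k j ≤ n)
    (hunif : ∀ i, 𝒜 i ⊆ kSubsets n (k i)) (hne : ∀ i, (𝒜 i).Nonempty)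
    (hcross : ∀ i j, i ≠ j → CrossIntersecting (𝒜 i) (𝒜 j))
    (hnd : 3 ≤ Fintype.card ι ∨ k first + k last < n) {i : ι}
    (hlow : (n - 1).choose (k i - 1) < #(𝒜 i))
    (hup : #(𝒜 i) + (n - k last).choose (k i) ≤ n.choose (k i)) :
    ∑ j, #(𝒜 j) ≤ max (meetContainBound n (k first) (univ.erase first) k (k last))
      (∑ j, (n - 1).choose (k j - 1)) ∧
    (∑ j, #(𝒜 j) = max (meetContainBound n (k first) (univ.erase first) k (k last))
        (∑ j, (n - 1).choose (k j - 1)) →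
      ∑ j, (n - 1).choose (k j - 1) ≤ meetContainBound n (k first) (univ.erase first) k (k last) ∧
      k i = k first ∧ ∃ T : Finset (Fin n), #T = k last ∧ 𝒜 i = meetingFamily (k i) T ∧
        ∀ j, j ≠ i → 𝒜 j = containingFamily (k j) T) := by
  have hn1 : k first + k last ≤ n := hn _ _ hfl
  have hkn : ∀ j, k j < n := fun j => by
    have h1 := hfirst j
    have h2 := hpos last
    lia
  have hM : 2 ≤ k last := by
    by_contra! h
    have h1 := hpos last
    have h2 := hkn i
    have h3 := Nat.choose_eq_choose_pred_add (n := n) (k := k i) (by lia) (hpos i)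
    rw [show k last = 1 by lia] at hup
    lia
  have hs : (∃ j ∈ univ.erase i, k i + k j < n) ∨ 2 ≤ #(univ.erase i) := by
    rcases hnd with h | h
    · right
      rw [card_erase_of_mem (mem_univ i), card_univ]
      lia
    · rcases eq_or_ne i first with rfl | h1
      · exact Or.inl ⟨last, mem_erase.2 ⟨hfl.symm, mem_univ _⟩, h⟩
      rcases eq_or_ne i last with rfl | h2
      · exact Or.inl ⟨first, mem_erase.2 ⟨hfl, mem_univ _⟩, by lia⟩
      right
      rw [← card_pair hfl]
      exact card_le_card (insert_subset (mem_erase.2 ⟨h1.symm, mem_univ _⟩)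
        (singleton_subset_iff.2 (mem_erase.2 ⟨h2.symm, mem_univ _⟩)))
  have hmain := card_add_sum_card_le (J := univ.erase i) (k := k) (B := 𝒜) (M := k last)
    (hunif i) (fun j _ => hunif j) (fun j hj => hcross i j (ne_of_mem_erase hj).symm) (hpos i)
    (by lia) (fun j _ => hlast j) (fun j hj => hn i j (ne_of_mem_erase hj).symm) hlow hup hs
  rw [add_sum_erase univ (fun j => #(𝒜 j)) (mem_univ i),
    meetContainBound_erase_one (by lia) i (hpos i)] at hmain
  set Y := ∑ j, (n - 1).choose (k j - 1) with hY
  set X := meetContainBound n (k first) (univ.erase first) k (k last) with hX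
  set Z := meetContainBound n (k i) (univ.erase i) k (k last) with hZ
  have eX := meetContainBound_erase_add (n := n) (k := k) first (k last)
  have eZ := meetContainBound_erase_add (n := n) (k := k) i (k last)
  rw [← hX] at eX
  rw [← hZ] at eZ
  have hZX : Z ≤ X := by
    rcases eq_or_ne i first with rfl | h
    · exact le_rfl
    · have := (choose_meeting_mono (n := n) hM (hlast i) (hfirst i) (hn i first h)).1
      lia
  refine ⟨hmain.1.trans (max_le (le_max_right _ _) (hZX.trans (le_max_left _ _))), fun heq => ?_⟩
  have hle : max Y Z ≤ max X Y := max_le (le_max_right _ _) (hZX.trans (le_max_left _ _))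
  have heq' : ∑ j, #(𝒜 j) = max Y Z := le_antisymm hmain.1 (heq ▸ hle)
  obtain ⟨hfull, hYZ⟩ := hmain.2 heq'
  rw [max_eq_right hYZ] at heq'
  have hXZ : X = Z := le_antisymm (by rw [← heq', heq]; exact le_max_left _ _) hZX
  have hki : k i = k first := by
    by_contra hne'
    have hlt : k i < k first := lt_of_le_of_ne (hfirst i) hne'
    have hif : i ≠ first := fun h => hne' (by rw [h])
    rcases (hn i first hif).eq_or_lt with h | h
    · -- If `k i + k first = n`, the full stars are strictly better.
      obtain ⟨j, hjf, hji⟩ : ∃ j, j ≠ first ∧ j ≠ i := by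
        rcases hnd with h3 | h3
        · obtain ⟨j, hj⟩ := exists_mem_notMem_of_card_lt_card
            (show #({first, i} : Finset ι) < #(univ : Finset ι) by
              rw [card_pair hif.symm, card_univ]; lia)
          simp only [mem_insert, mem_singleton, not_or] at hj
          exact ⟨j, hj.2⟩
        · refine ⟨last, hfl.symm, ?_⟩
          rintro rfl
          lia
      have := meetContainBound_lt_one (J := univ.erase first) hM (hpos first)
        (fun j _ => hlast j) (fun j hj => hn first j (ne_of_mem_erase hj).symm)
        (mem_erase.2 ⟨hif, mem_univ i⟩) (mem_erase.2 ⟨hjf, mem_univ j⟩) hji.symm (by lia)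
      rw [meetContainBound_erase_one (by lia) first (hpos first)] at this
      lia
    · have := (choose_meeting_mono (n := n) hM (hlast i) (hfirst i) (hn i first hif)).2 hlt h
      lia
  exact ⟨hYZ.trans hZX, hki,
    eq_meeting_containing hlast hfl hpos hn hunif hne hcross hki hfull heq'⟩

/-- If some family is larger than the family of sets meeting a `k last`-set, the total size is
strictly below the bound. -/
lemma sum_card_lt_of_very_large (hlast : ∀ i, k last ≤ k i)
    (hfl : first ≠ last) (hpos : ∀ i, 1 ≤ k i) (hn : ∀ i j, i ≠ j → k i + k j ≤ n)
    (hunif : ∀ i, 𝒜 i ⊆ kSubsets n (k i)) (hne : ∀ i, (𝒜 i).Nonempty)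
    (hcross : ∀ i j, i ≠ j → CrossIntersecting (𝒜 i) (𝒜 j))
    (hnd : 3 ≤ Fintype.card ι ∨ k first + k last < n) {i : ι}
    (hlow : (n - 1).choose (k i - 1) < #(𝒜 i))
    (hup : n.choose (k i) < #(𝒜 i) + (n - k last).choose (k i)) :
    ∑ j, #(𝒜 j) < meetContainBound n (k first) (univ.erase first) k (k last) := by
  have hsmall : ∀ j, j ≠ i → #(𝒜 j) < (n - k last).choose (k j - k last) := fun j hj => by
    by_contra! h
    have := (hcross i j hj.symm).card_add_choose_le (hunif i) (hunif j) (hn i j hj.symm)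
      (hlast j) h
    lia
  have hbig : ∀ j, j ≠ i → k last < k j := fun j hj => by
    refine lt_of_le_of_ne (hlast j) fun h => ?_
    have h1 := hsmall j hj
    have h2 := (hne j).card_pos
    rw [h, Nat.sub_self, Nat.choose_zero_right] at h1
    lia
  obtain rfl : last = i := by
    by_contra h
    exact lt_irrefl _ (hbig last h)
  have htwo := (hcross last first hfl.symm).card_add_card_le (hunif last) (hunif first) (hne first)
    (hpos last) (hbig first hfl) (hn last first hfl.symm) hlow
  set R := (univ.erase first).erase last with hR
  have hmem : last ∈ univ.erase first := mem_erase.2 ⟨hfl.symm, mem_univ _⟩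
  have hle : ∀ j ∈ R, #(𝒜 j) ≤ (n - k last).choose (k j - k last) := fun j hj =>
    (hsmall j (ne_of_mem_erase hj)).le
  have hsum := sum_le_sum hle
  rw [← add_sum_erase univ (fun j => #(𝒜 j)) (mem_univ first), meetContainBound,
    ← add_sum_erase _ (fun j => #(𝒜 j)) hmem,
    ← add_sum_erase _ (fun j => (n - k last).choose (k j - k last)) hmem]
  simp only [Nat.sub_self, Nat.choose_zero_right]
  have hcl := Nat.choose_le_choose (k first) (show n - k last ≤ n by lia)
  rcases hnd with h | h
  · have hRne : R.Nonempty := by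
      refine card_pos.1 ?_
      rw [hR, card_erase_of_mem hmem, card_erase_of_mem (mem_univ _), card_univ]
      lia
    have := sum_lt_sum_of_nonempty hRne fun j hj => hsmall j (ne_of_mem_erase hj)
    have := htwo.1
    lia
  · have := htwo.2 (by lia)
    lia

/-- For `n = 2 a`, at least three pairwise cross-intersecting families of `a`-sets, each containing
half of all `a`-sets, coincide and contain one set of each complementary pair. -/
lemma eq_sdiff_compls_of_forall_card {a : ℕ} (ha : 1 ≤ a) (hn : n = a + a)
    (hunif : ∀ i, 𝒜 i ⊆ kSubsets n a)
    (hcross : ∀ i j, i ≠ j → CrossIntersecting (𝒜 i) (𝒜 j))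
    (hcard : ∀ i, #(𝒜 i) = (n - 1).choose (a - 1)) (hι : 3 ≤ Fintype.card ι) (i j : ι) :
    𝒜 j = kSubsets n a \ (𝒜 i)ᶜˢ := by
  have hne : ∀ p q, p ≠ q → 𝒜 q = kSubsets n a \ (𝒜 p)ᶜˢ := fun p q hpq => by
    refine (hcross p q hpq).eq_sdiff_compls (hunif p) (hunif q) hn ?_
    have h1 := Nat.choose_eq_choose_pred_add (n := n) (k := a) (by lia) ha
    have h2 : (n - 1).choose (a - 1) = (n - 1).choose a := Nat.choose_symm_of_eq_add (by lia)
    rw [hcard, hcard]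
    lia
  rcases eq_or_ne i j with rfl | h
  · -- Compare `𝒜 i` with two further families `𝒜 p` and `𝒜 q`.
    obtain ⟨p, hp⟩ := exists_mem_notMem_of_card_lt_card
      (show #({i} : Finset ι) < #(univ : Finset ι) by rw [card_singleton, card_univ]; lia)
    simp only [mem_singleton] at hp
    obtain ⟨q, hq⟩ := exists_mem_notMem_of_card_lt_card
      (show #({i, p} : Finset ι) < #(univ : Finset ι) by
        rw [card_pair (Ne.symm hp.2), card_univ]; lia)
    simp only [mem_insert, mem_singleton, not_or] at hq
    rw [← hne i q (Ne.symm hq.2.1), hne p q (Ne.symm hq.2.2)]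
    exact hne p i hp.2
  · exact hne i j h

end LargeFamily

theorem theorem2 (n t : ℕ) (ht : 2 ≤ t) (k : Fin t → ℕ)
    (first second last : Fin t)
    (hfirst : first.val = 0) (hsecond : second.val = 1) (hlast : last.val = t - 1)
    (hk : Antitone k) (hn : k first + k second ≤ n)
    (𝒜 : Fin t → Finset (Finset (Fin n)))
    (hunif : ∀ i, 𝒜 i ⊆ kSubsets n (k i))
    (hcross : NonemptyPairwiseCrossIntersecting 𝒜) :
    ∑ i, (𝒜 i).card ≤ max (meetingBound n k first last) (starBound n k) ∧
    (∑ i, (𝒜 i).card = max (meetingBound n k first last) (starBound n k) ↔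
      -- (i) one family of the largest uniformity meets a set `T`, all the others contain `T`
      (starBound n k ≤ meetingBound n k first last ∧
        ∃ s : Fin t, k s = k first ∧ ∃ T : Finset (Fin n), T.card = k last ∧
          𝒜 s = meetingFamily (k s) T ∧ ∀ j, j ≠ s → 𝒜 j = containingFamily (k j) T) ∨
      -- (ii) full stars with a common centre
      (meetingBound n k first last ≤ starBound n k ∧
        (∃ i j : Fin t, i ≠ j ∧ k i + k j < n) ∧
        ∃ a : Fin n, ∀ j, 𝒜 j = fullStar (k j) a) ∨
      -- (iii) two families, complementary to each other
      (t = 2 ∧ n = k first + k second ∧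
        𝒜 second = kSubsets n (k second) \ (𝒜 first).compls) ∨
      -- (iv) equal families containing one set of each complementary pair
      (3 ≤ t ∧ (∀ i, k i = k first) ∧ n = 2 * k first ∧
        ∀ i, 𝒜 i = kSubsets n (k first) \ (𝒜 first).compls)) := by
  obtain ⟨hne, hcr⟩ := hcross
  have hcr' : ∀ i j, i ≠ j → CrossIntersecting (𝒜 i) (𝒜 j) := fun i j hij => by
    rcases lt_or_gt_of_ne hij with h | h
    · exact hcr i j h
    · exact (hcr j i h).symm
  have hfl : first ≠ last := fun h => by rw [Fin.ext_iff] at h; lia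
  have hfs : first ≠ second := fun h => by rw [Fin.ext_iff] at h; lia
  have hkf : ∀ i, k i ≤ k first := fun i => hk (Fin.le_def.2 (by lia))
  have hkl : ∀ i, k last ≤ k i := fun i => hk (Fin.le_def.2 (by have := i.isLt; lia))
  have hks : ∀ i, i ≠ first → k i ≤ k second := fun i hi => hk (Fin.le_def.2 (by
    have : i.val ≠ first.val := fun h => hi (Fin.ext h)
    lia))
  have hn' : ∀ i j, i ≠ j → k i + k j ≤ n := fun i j hij => by
    rcases eq_or_ne i first with rfl | hi
    · have := hks j hij.symm
      lia
    · have h1 := hks i hi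
      have h2 := hkf j
      lia
  -- The empty set is not a member of any of the families.
  have hpos : ∀ i, 1 ≤ k i := fun i => by
    obtain ⟨j, hj⟩ : ∃ j, i ≠ j := by
      rcases eq_or_ne i first with rfl | h
      · exact ⟨last, hfl⟩
      · exact ⟨first, h⟩
    obtain ⟨F, hF⟩ := hne i
    obtain ⟨G, hG⟩ := hne j
    rw [← mem_kSubsets.1 (hunif i hF)]
    exact ((hcr' i j hj F hF G hG).mono inter_subset_left).card_pos
  have hp1 := hpos first
  have hp2 := hpos second
  have hX : meetingBound n k first last
      = meetContainBound n (k first) (univ.erase first) k (k last) := rfl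
  have hY : starBound n k = ∑ i, (n - 1).choose (k i - 1) := rfl
  have hY1 : meetContainBound n (k first) (univ.erase first) k 1 = starBound n k :=
    meetContainBound_erase_one (by lia) first hp1
  have hsum2 : t = 2 → ∀ f : Fin t → ℕ, ∑ i, f i = f first + f second := by
    rintro rfl f
    rw [Fin.sum_univ_two, show first = 0 from Fin.ext hfirst, show second = 1 from Fin.ext hsecond]
  -- For two families with `n = k first + k second` both bounds equal `n.choose (k first)`.
  have htwo : t = 2 → n = k first + k second →
      max (meetingBound n k first last) (starBound n k) = n.choose (k first) := by
    intro h2 hnk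
    have hls : last = second := Fin.ext (by lia)
    have hYv : starBound n k = n.choose (k first) := by
      rw [hY, hsum2 h2, Nat.choose_eq_choose_pred_add (n := n) (k := k first) (by lia) hp1]
      congr 1
      exact Nat.choose_symm_of_eq_add (by lia)
    have hXv : meetingBound n k first last = n.choose (k first) := by
      have h3 := add_sum_erase univ (fun i => (n - k second).choose (k i - k second))
        (mem_univ first)
      rw [hsum2 h2] at h3
      have h4 : ∑ i ∈ univ.erase first, (n - k second).choose (k i - k second) = 1 := by
        simpa using h3
      have h5 : 0 < n.choose (k first) := Nat.choose_pos (by lia)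
      rw [meetingBound, hls, h4, show n - k second = k first by lia, Nat.choose_self]
      lia
    rw [hXv, hYv, max_self]
  have hback : ((starBound n k ≤ meetingBound n k first last ∧
        ∃ s : Fin t, k s = k first ∧ ∃ T : Finset (Fin n), T.card = k last ∧
          𝒜 s = meetingFamily (k s) T ∧ ∀ j, j ≠ s → 𝒜 j = containingFamily (k j) T) ∨
      (meetingBound n k first last ≤ starBound n k ∧
        (∃ i j : Fin t, i ≠ j ∧ k i + k j < n) ∧
        ∃ a : Fin n, ∀ j, 𝒜 j = fullStar (k j) a) ∨
      (t = 2 ∧ n = k first + k second ∧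
        𝒜 second = kSubsets n (k second) \ (𝒜 first).compls) ∨
      (3 ≤ t ∧ (∀ i, k i = k first) ∧ n = 2 * k first ∧
        ∀ i, 𝒜 i = kSubsets n (k first) \ (𝒜 first).compls)) →
      ∑ i, (𝒜 i).card = max (meetingBound n k first last) (starBound n k) := by
    rintro (⟨hle, s, hs, T, hT, hmeet, hcont⟩ | ⟨hle, -, a, ha⟩ | ⟨h2, hnk, hA⟩ | ⟨h3, hall, hnk, hA⟩)
    · rw [max_eq_left hle, hX]
      have e1 := meetContainBound_erase_add (n := n) (k := k) first (k last)
      have e2 := card_meetingFamily_add (k := k s) (T := T)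
      have e3 : ∑ i ∈ univ.erase s, #(𝒜 i)
          = ∑ i ∈ univ.erase s, (n - k last).choose (k i - k last) :=
        sum_congr rfl fun j hj => by
          rw [hcont j (ne_of_mem_erase hj), card_containingFamily (by rw [hT]; exact hkl j), hT]
      have e4 := add_sum_erase univ (fun i => (n - k last).choose (k i - k last)) (mem_univ s)
      rw [← add_sum_erase univ (fun i => #(𝒜 i)) (mem_univ s), e3, hmeet]
      rw [hT, hs] at e2
      rw [hs] at e4 ⊢
      lia
    · rw [max_eq_right hle, hY]
      exact sum_congr rfl fun j _ => by rw [ha j, card_fullStar (hpos j)]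
    · rw [htwo h2 hnk, hsum2 h2, hA]
      have := card_kSubsets_sdiff_compls (hunif first) hnk
      rw [Nat.choose_symm_of_eq_add hnk]
      lia
    · have hle : meetingBound n k first last ≤ starBound n k := by
        rw [← hY1, hX]
        rcases (hpos last).eq_or_lt with h | h
        · rw [← h]
        · refine (meetContainBound_lt_one h hp1 (fun j _ => hkl j)
            (fun j hj => hn' first j (ne_of_mem_erase hj).symm)
            (mem_erase.2 ⟨hfs.symm, mem_univ second⟩) (mem_erase.2 ⟨hfl.symm, mem_univ last⟩)
            (fun h => ?_) (by rw [hall second]; lia)).le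
          rw [Fin.ext_iff] at h
          lia
      rw [max_eq_right hle, hY]
      have hunif' := hunif first
      have h1 := card_kSubsets_sdiff_compls hunif' (show n = k first + k first by lia)
      have h2 := Nat.choose_eq_choose_pred_add (n := n) (k := k first) (by lia) hp1
      have h4 : (n - 1).choose (k first - 1) = (n - 1).choose (k first) :=
        Nat.choose_symm_of_eq_add (by lia)
      have h5 := congrArg card (hA first)
      refine sum_congr rfl fun j _ => ?_
      rw [hA j, hall j]
      lia
  suffices hfwd : ∑ i, (𝒜 i).card ≤ max (meetingBound n k first last) (starBound n k) ∧
      (∑ i, (𝒜 i).card = max (meetingBound n k first last) (starBound n k) → _) from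
    ⟨hfwd.1, hfwd.2, hback⟩
  by_cases hdeg : t = 2 ∧ n = k first + k second
  · obtain ⟨h2, hnk⟩ := hdeg
    rw [htwo h2 hnk, hsum2 h2, Nat.choose_symm_of_eq_add hnk]
    have h1 := card_kSubsets_sdiff_compls (hunif first) hnk
    have h3 := card_le_card ((hcr' first second hfs).subset_sdiff_compls (hunif second))
    refine ⟨by lia, fun heq => Or.inr (Or.inr (Or.inl ⟨h2, hnk, ?_⟩))⟩
    exact (hcr' first second hfs).eq_sdiff_compls (hunif first) (hunif second) hnk heq.ge
  have hnd : 3 ≤ Fintype.card (Fin t) ∨ k first + k last < n := by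
    rw [Fintype.card_fin]
    by_cases h3 : 3 ≤ t
    · exact Or.inl h3
    · right
      rw [show last = second from Fin.ext (by lia)]
      have : n ≠ k first + k second := fun h => hdeg ⟨by lia, h⟩
      lia
  by_cases hlarge : ∃ i, (n - 1).choose (k i - 1) < #(𝒜 i)
  · obtain ⟨i, hi⟩ := hlarge
    rcases le_or_gt (#(𝒜 i) + (n - k last).choose (k i)) (n.choose (k i)) with hup | hup
    · have h := sum_card_le_of_large hkf hkl hfl hpos hn' hunif hne hcr' hnd hi hup
      exact ⟨h.1, fun heq => Or.inl ⟨(h.2 heq).1, i, (h.2 heq).2⟩⟩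
    · have h := (sum_card_lt_of_very_large hkl hfl hpos hn' hunif hne hcr' hnd hi hup).trans_le
        (le_max_left _ (starBound n k))
      exact ⟨h.le, fun heq => absurd heq h.ne⟩
  · push Not at hlarge
    have hle : ∑ i, #(𝒜 i) ≤ starBound n k := sum_le_sum fun i _ => hlarge i
    refine ⟨hle.trans (le_max_right _ _), fun heq => Or.inr ?_⟩
    have hXY : meetingBound n k first last ≤ starBound n k :=
      (le_max_left _ _).trans (heq ▸ hle)
    rw [max_eq_right hXY] at heq
    have hcard : ∀ i, #(𝒜 i) = (n - 1).choose (k i - 1) := fun i =>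
      (sum_eq_sum_iff_of_le fun i _ => hlarge i).1 heq i (mem_univ i)
    by_cases hlt : ∃ i j : Fin t, i ≠ j ∧ k i + k j < n
    · obtain ⟨i, j, hij, hlt'⟩ := hlt
      exact Or.inl ⟨hXY, ⟨i, j, hij, hlt'⟩,
        exists_forall_eq_fullStar hpos hn' hunif hcr' hcard hij hlt'⟩
    · have hall : ∀ i j, i ≠ j → k i + k j = n := fun i j hij => by
        by_contra h
        exact hlt ⟨i, j, hij, lt_of_le_of_ne (hn' i j hij) h⟩
      have h3 : 3 ≤ t := by
        rcases hnd with h | h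
        · rwa [Fintype.card_fin] at h
        · exact absurd (hall first last hfl) h.ne
      have hsl : second ≠ last := fun h => by rw [Fin.ext_iff] at h; lia
      have e1 := hall first second hfs
      have e2 := hall first last hfl
      have e3 := hall second last hsl
      have hkeq : ∀ i, k i = k first := fun i => by
        have := hkf i
        have := hkl i
        lia
      refine Or.inr (Or.inr ⟨h3, hkeq, by lia, fun i => ?_⟩)
      refine eq_sdiff_compls_of_forall_card hp1 (by lia) (fun i => hkeq i ▸ hunif i) hcr'
        (fun i => hkeq i ▸ hcard i) (by rwa [Fintype.card_fin]) first i
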